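/- Let $(R,\mathfrak m)$ be a Gorenstein local ring with $\dim R = 1$, and let $I$ be a non-zero ideal of $R$ such that $R/I$ is a Cohen–Macaulay ring with $\dim R/I = 1$. Put $J = (0):_R I$, and let $A = R\ltimes I$ be the idealization of $I$ over $R$, that is, $R\oplus I$ with the multiplication $(a,x)(b,y) = (ab, bx+ay)$. Suppose that $A$ is an almost Gorenstein local ring. Then both $R/I$ and $R/J$ are discrete valuation rings, and $\mu_R(I)=\mu_R(J)=1$. Consequently, if $R$ is a homomorphic image of a regular local ring, then there are a two-dimensional regular local ring $(S,\mathfrak n)$, elements $X,Y$ with $\mathfrak n=(X,Y)$, and an isomorphism of rings $S/[(X)\cap(Y)]\cong R$ such that $I=(x)$ and $J=(y)$, where $x,y\in R$ denote the images of $X,Y$. Here $\mu$ denotes the minimal number of generators, and a Cohen–Macaulay local ring $(B,\mathfrak M)$ of dimension $d$ possessing a canonical module $K_B$ is called almost Gorenstein if there is an exact sequence $0\to B\to K_B\to C\to 0$ of $B$-modules such that either $C=0$, or $C\neq 0$ and $\mu_B(C)$ equals the multiplicity $e^0_{\mathfrak M}(C)=\lim_{n\to\infty}(d-1)!\cdot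 \ell_B(C/\mathfrak M^{n+1}C)/n^{d-1}$. -/

import Mathlib

universe u v

open CategoryTheory IsLocalRing

/-- A finitely generated module `M` over a Noetherian local ring `A` is maximal Cohen-Macaulay if
`depth M = dim A`, that is, if the maximal ideal contains an `M`-regular sequence of length `dim A`
(no `M`-regular sequence in the maximal ideal is longer than `dim A`). -/
class IsMaximalCohenMacaulay (A : Type u) [CommRing A] [IsLocalRing A] [IsNoetherianRing A]
    (M : Type v) [AddCommGroup M] [Module A M] : Prop extends Module.Finite A M where
  exists_isRegular : ∃ rs : List A, (∀ r ∈ rs, r ∈ maximalIdeal A) ∧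
    RingTheory.Sequence.IsRegular M rs ∧ ringKrullDim A = rs.length

/-- A Cohen-Macaulay local ring: a Noetherian local ring `A` with `depth A = dim A`. -/
class IsCohenMacaulayLocalRing (A : Type u) [CommRing A] : Prop extends
    IsLocalRing A, IsNoetherianRing A where
  isMaximalCohenMacaulay : IsMaximalCohenMacaulay A A

/-- A Gorenstein local ring: a Noetherian local ring of finite injective dimension as a module over
itself. -/
class IsGorensteinLocalRing (A : Type u) [CommRing A] : Prop extends
    IsLocalRing A, IsNoetherianRing A where
  exists_hasInjectiveDimensionLE : ∃ n : ℕ, HasInjectiveDimensionLE (ModuleCat.of A A) n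

/-- A canonical module of a Cohen-Macaulay local ring `A` of dimension `d`: a maximal
Cohen-Macaulay module `K` of finite injective dimension and of type one, where the type is the
dimension of `Ext^d(k, K)` over the residue field `k` (equivalently its length over `A`, as it is
annihilated by the maximal ideal). -/
class IsCanonicalModule (A : Type u) [CommRing A] [IsLocalRing A] [IsNoetherianRing A]
    (K : Type u) [AddCommGroup K] [Module A K] : Prop extends IsMaximalCohenMacaulay A K where
  exists_hasInjectiveDimensionLE : ∃ n : ℕ, HasInjectiveDimensionLE (ModuleCat.of A K) n
  type_eq_one : ∃ d : ℕ, ringKrullDim A = d ∧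
    Module.length A (Abelian.Ext (ModuleCat.of A (ResidueField A)) (ModuleCat.of A K) d) = 1

/-- `μ_A(C)`, the number of elements in a minimal system of generators of `C`. -/
noncomputable def minGenerators (A : Type u) [CommRing A]
    (C : Type v) [AddCommGroup C] [Module A C] : ℕ :=
  (⊤ : Submodule A C).spanFinrank

/-- `e` is the multiplicity of the finitely generated module `C` over the Noetherian local ring `A`
of dimension `d` with respect to the maximal ideal `𝔪`:
`e = lim_{n → ∞} (d - 1)! * ℓ(C / 𝔪 ^ (n + 1) C) / n ^ (d - 1)`. All the lengths are finite. -/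
def HasMultiplicity (A : Type u) [CommRing A] [IsLocalRing A] (d : ℕ)
    (C : Type v) [AddCommGroup C] [Module A C] (e : ℝ) : Prop :=
  Filter.Tendsto (fun n : ℕ => ((d - 1).factorial : ℝ) *
      ((Module.length A (C ⧸ ((maximalIdeal A) ^ (n + 1) • (⊤ : Submodule A C)))).toNat : ℝ) /
        (n : ℝ) ^ (d - 1))
    Filter.atTop (nhds e)

/-- An almost Gorenstein local ring: a Cohen-Macaulay local ring `A` of dimension `d` possessing a
canonical module `K` and an exact sequence `0 → A → K → C → 0` such that either `C = 0`, or `C ≠ 0`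
and `μ_A(C)` equals the multiplicity of `C`. -/
class IsAlmostGorensteinLocalRing (A : Type u) [CommRing A] : Prop extends
    IsCohenMacaulayLocalRing A where
  exists_exact : ∃ (d : ℕ) (K : Type u) (_ : AddCommGroup K) (_ : Module A K),
    ringKrullDim A = d ∧ IsCanonicalModule A K ∧
      ∃ φ : A →ₗ[A] K, Function.Injective φ ∧
        (Subsingleton (K ⧸ LinearMap.range φ) ∨
          (Nontrivial (K ⧸ LinearMap.range φ) ∧
            HasMultiplicity A d (K ⧸ LinearMap.range φ)
              (minGenerators A (K ⧸ LinearMap.range φ))))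

/-! In dimension one the multiplicity condition means that the maximal ideal of `A` kills the
cokernel `C` of `A → K`. The integers `ℓ(C / 𝔪ⁿ⁺¹C)` converge to `μ(C) = ℓ(C / 𝔪C)`, hence stabilize
there, and Nakayama gives `𝔪C = 0` (`HasMultiplicity.smul_eq_zero`). For a regular `t`, the preimage
`P` of `tK` in `A` then satisfies `tA ⊆ P` and `𝔪_A P ⊆ tA`; since `A / P` embeds in `K / tK` and
`K` has type one, the socle of `A / P` is cyclic (`exists_isSocleIdeal`).

On the side of `R`, finite injective dimension makes `R / t` Artinian and self-injective. So ideals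
are double annihilators modulo `t`, and annihilators of ideals `L` with `R / L` free of `t`-torsion
lift from `R / t` to `R`.

Take `t ∈ 𝔪²` regular on `R` and on `R / I`, and `s ∈ I` generating the socle of `R / t`. If `(0, s)
∈ P`, cyclicity forces `I = (s)` and then `𝔪 ⊆ J`, which is absurd. Otherwise `(0, s)` generates the
socle of `A / P`, which forces `I ∩ (J + tR) ⊆ (s, t)`. By duality `𝔪 ⊆ I + J + tR`, and `t ∈ 𝔪²`
gives `𝔪 = I + J` (`maximalIdeal_le_sup_of_isSocleIdeal`).

This sum is direct, and another socle argument makes both summands principal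
(`exists_eq_span_singleton_of_sup_eq`). With `𝔪 = (x, y)` and `xy = 0`, both quotients have a
principal, non-nilpotent maximal ideal. For the presentation, a regular local ring mapping onto `R`
is cut down until the kernel lies in the square of its maximal ideal; lifts `X, Y` then generate
that ideal and the kernel is `(X) ∩ (Y)`. -/

section ExtGroups

/-! ### Ext groups: self-injectivity of `R / t` and the socle of `K / tK`. -/

open Pointwise Abelian

/-- Extending a morphism from a subobject, by a comparison of two long exact sequences. -/
lemma exists_extend_of_subsingleton_ext_two {C : Type*} [Category* C] [Abelian C] [HasExt.{u} C]
    {S T : ShortComplex C} (hS : S.ShortExact) (hT : T.ShortExact)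
    (h2 : Subsingleton (Ext S.X₃ T.X₁ 2))
    (h1 : ∀ e : Ext S.X₂ T.X₁ 1, e.comp (Ext.mk₀ T.f) (add_zero 1) = 0)
    (h0 : ∀ f : S.X₁ ⟶ T.X₂, f = 0) (g : S.X₁ ⟶ T.X₃) :
    ∃ h : S.X₂ ⟶ T.X₃, S.f ≫ h = g := by
  -- The connecting class of `g` extends to `S.X₂`, as its obstruction lies in `Ext²(S.X₃, T.X₁) =
  -- 0`; the extended class dies in `T.X₂`, so it is the connecting class of some `h`.
  obtain ⟨e, he⟩ := Ext.contravariant_sequence_exact₁ hS T.X₁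
    ((Ext.mk₀ g).comp hT.extClass (zero_add 1)) (n₁ := 2) rfl (h2.elim _ _)
  obtain ⟨h, hh⟩ := Ext.covariant_sequence_exact₁ S.X₂ hT e (h1 e) (zero_add 1)
  obtain ⟨h, rfl⟩ := (Ext.mk₀_bijective _ _).2 h
  have key : (Ext.mk₀ (S.f ≫ h - g)).comp hT.extClass (zero_add 1) = 0 := by
    rw [sub_eq_add_neg, Ext.mk₀_add, Ext.mk₀_neg, Ext.add_comp, Ext.neg_comp, ← he, ← hh,
      ← Ext.mk₀_comp_mk₀, Ext.comp_assoc_of_second_deg_zero, add_neg_cancel]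
  -- The error `S.f ≫ h - g` factors through `T.X₂`, and there are no such non-zero morphisms.
  obtain ⟨x, hx⟩ := Ext.covariant_sequence_exact₃ S.X₁ hT _ (zero_add 1) key
  obtain ⟨x, rfl⟩ := (Ext.mk₀_bijective _ _).2 x
  rw [h0 x, Ext.mk₀_zero, Ext.zero_comp] at hx
  refine ⟨h, sub_eq_zero.mp ((Ext.mk₀_bijective _ _).1 ?_)⟩
  rw [← hx, Ext.mk₀_zero]

/-- A linear map that vanishes on the kernel of `p` factors through the range of `p`. -/
lemma LinearMap.exists_factor_rangeRestrict {R M N Z : Type*} [Ring R] [AddCommGroup M]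
    [AddCommGroup N] [AddCommGroup Z] [Module R M] [Module R N] [Module R Z]
    (p : M →ₗ[R] N) (g : M →ₗ[R] Z) (h : LinearMap.ker p ≤ LinearMap.ker g) :
    ∃ f : LinearMap.range p →ₗ[R] Z, ∀ x, f (p.rangeRestrict x) = g x := by
  refine ⟨(LinearMap.ker p).liftQ g h ∘ₗ p.quotKerEquivRange.symm.toLinearMap, fun x => ?_⟩
  have h2 : p.quotKerEquivRange.symm (p.rangeRestrict x) = (LinearMap.ker p).mkQ x := by
    rw [LinearEquiv.symm_apply_eq]; rfl
  simp only [LinearMap.comp_apply, LinearEquiv.coe_coe, h2]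
  rfl

section ExtVanishing

variable {R : Type u} [CommRing R]

/-- The short exact sequence attached to a submodule. -/
lemma Submodule.shortComplex_shortExact {M : Type u} [AddCommGroup M] [Module R M]
    (P : Submodule R M) :
    (ModuleCat.shortComplexOfCompEqZero P.subtype P.mkQ
      (LinearMap.exact_subtype_mkQ P).linearMap_comp_eq_zero).ShortExact :=
  ModuleCat.shortComplex_shortExact _ (LinearMap.exact_subtype_mkQ P)
    P.injective_subtype P.mkQ_surjective

/-- `Ext` into `R` from a finite length module vanishes as soon as it vanishes for simple
modules. -/
lemma subsingleton_ext_of_isFiniteLength {Y : ModuleCat.{u} R} {i : ℕ}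
    (h : ∀ (N : Type u) [AddCommGroup N] [Module R N], IsSimpleModule R N →
      Subsingleton (Ext (ModuleCat.of R N) Y i))
    {N : Type u} [AddCommGroup N] [Module R N] (hN : IsFiniteLength R N) :
    Subsingleton (Ext (ModuleCat.of R N) Y i) := by
  induction hN with
  | @of_subsingleton M _ _ _ =>
    have : Limits.IsZero (ModuleCat.of R M) := ModuleCat.isZero_of_subsingleton _
    refine subsingleton_of_forall_eq 0 fun x => ?_
    rw [← Ext.mk₀_id_comp x, this.eq_of_src (𝟙 _) 0, Ext.mk₀_zero, Ext.zero_comp]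
  | @of_simple_quotient M _ _ P _ hP ih =>
    have hq := h (M ⧸ P) inferInstance
    refine subsingleton_of_forall_eq 0 fun x => ?_
    obtain ⟨y, rfl⟩ := Ext.contravariant_sequence_exact₂ P.shortComplex_shortExact Y x
      (ih.elim _ _)
    have : y = 0 := hq.elim _ _
    rw [this, Ext.comp_zero]

variable [IsLocalRing R]

/-- A simple module over a local ring is a copy of any other one. -/
lemma nonempty_linearEquiv_of_isSimpleModule (N N' : Type*) [AddCommGroup N] [Module R N]
    [AddCommGroup N'] [Module R N'] (h : IsSimpleModule R N) (h' : IsSimpleModule R N') :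
    Nonempty (N ≃ₗ[R] N') := by
  obtain ⟨m, hm, ⟨e⟩⟩ := isSimpleModule_iff_quot_maximal.mp h
  obtain ⟨m', hm', ⟨e'⟩⟩ := isSimpleModule_iff_quot_maximal.mp h'
  obtain rfl := eq_maximalIdeal hm
  obtain rfl := eq_maximalIdeal hm'
  exact ⟨e.trans e'.symm⟩

/-- Over a local ring of finite self-injective dimension, with a regular element `t` such that
`R / t` has finite length, `Ext ^ i` from a finite length module into `R` vanishes for `i ≥ 2`. -/
lemma subsingleton_ext_of_two_le {n : ℕ} (hn : HasInjectiveDimensionLE (ModuleCat.of R R) n)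
    {t : R} (ht : IsSMulRegular R t) (htm : t ∈ maximalIdeal R)
    (hfl : IsFiniteLength R (R ⧸ t • (⊤ : Submodule R R)))
    {i : ℕ} (hi : 2 ≤ i) {N : Type u} [AddCommGroup N] [Module R N] (hN : IsFiniteLength R N) :
    Subsingleton (Ext (ModuleCat.of R N) (ModuleCat.of R R) i) := by
  -- Descending induction on `i`, starting above the injective dimension; `k` bounds the distance to
  -- that range.
  obtain ⟨k, hk⟩ : ∃ k, n + 1 ≤ i + k := ⟨n + 1, by omega⟩
  induction k generalizing i N with
  | zero => exact HasInjectiveDimensionLT.subsingleton _ (n + 1) i hk _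
  | succ k ih =>
    refine subsingleton_ext_of_isFiniteLength (fun N' _ _ hN' => ?_) hN
    -- The resolution `0 → R → R → R / t → 0` by multiplication by `t` leaves no Ext in degrees `≥
    -- 2`.
    have hRt : Subsingleton (Ext (ModuleCat.of R (R ⧸ t • (⊤ : Submodule R R)))
        (ModuleCat.of R R) i) := by
      obtain ⟨j, rfl⟩ : ∃ j, i = 1 + (j + 1) := ⟨i - 2, by omega⟩
      have hproj : Projective (ModuleCat.of R R) := inferInstance
      refine subsingleton_of_forall_eq 0 fun x => ?_
      obtain ⟨y, rfl⟩ := Ext.contravariant_sequence_exact₃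
        (IsSMulRegular.smulShortComplex_shortExact (M := ModuleCat.of R R) ht) _ x
        (by
          obtain ⟨j', hj'⟩ : ∃ j', 1 + (j + 1) = j' + 1 := ⟨j + 1, by omega⟩
          revert x; rw [hj']; intro x
          exact Ext.eq_zero_of_projective (P := ModuleCat.of R R) _) rfl
      have : y = 0 := Ext.eq_zero_of_projective (P := ModuleCat.of R R) _
      subst this; simp; rfl
    have hnt : Nontrivial (R ⧸ t • (⊤ : Submodule R R)) := by
      rw [Submodule.Quotient.nontrivial_iff]
      intro h
      have h1 : (1 : R) ∈ t • (⊤ : Submodule R R) := by rw [h]; trivial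
      obtain ⟨y, -, hy⟩ := Submodule.mem_smul_pointwise_iff_exists _ _ _ |>.mp h1
      refine (maximalIdeal.isMaximal R).ne_top ((Ideal.eq_top_iff_one _).mpr ?_)
      rw [← hy]; exact Ideal.mul_mem_right _ _ htm
    have := (isFiniteLength_iff_isNoetherian_isArtinian.mp hfl).2
    -- The residue field embeds in `R / t` as `P`, so its `Extⁱ` sits between `Extⁱ(R / t, R) = 0`
    -- and `Extⁱ⁺¹` of `(R / t) / P`, which vanishes by induction.
    obtain ⟨P, hP⟩ := IsAtomic.exists_atom (Submodule R (R ⧸ t • (⊤ : Submodule R R)))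
    have hPs : IsSimpleModule R P := isSimpleModule_iff_isAtom.mpr hP
    obtain ⟨e⟩ := nonempty_linearEquiv_of_isSimpleModule (R := R) N' P hN' hPs
    have hS := P.shortComplex_shortExact
    have hq := ih (i := 1 + i) (by omega) (N := (R ⧸ t • (⊤ : Submodule R R)) ⧸ P)
      (hfl.of_surjective P.mkQ_surjective) (by omega)
    have hPz : Subsingleton (Ext (ModuleCat.of R P) (ModuleCat.of R R) i) := by
      refine subsingleton_of_forall_eq 0 fun x => ?_
      obtain ⟨y, rfl⟩ := Ext.contravariant_sequence_exact₁ hS _ x rfl (hq.elim _ _)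
      have : y = 0 := hRt.elim _ _
      rw [this, Ext.comp_zero]
    refine subsingleton_of_forall_eq 0 fun x => ?_
    have hid : x = (Ext.mk₀ e.toModuleIso.hom).comp
        ((Ext.mk₀ e.toModuleIso.inv).comp x (zero_add _)) (zero_add _) := by
      rw [Ext.mk₀_comp_mk₀_assoc, Iso.hom_inv_id, Ext.mk₀_id_comp]
    have h0 : (Ext.mk₀ e.toModuleIso.inv).comp x (zero_add _) = 0 := hPz.elim _ _
    rw [hid, h0, Ext.comp_zero]

/-- If `t` is a regular element of the one-dimensional Gorenstein local ring `R`, then `R / t` is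
self-injective. -/
lemma exists_extend_quotient_smul_top {n : ℕ}
    (hn : HasInjectiveDimensionLE (ModuleCat.of R R) n)
    {t : R} (ht : IsSMulRegular R t) (htm : t ∈ maximalIdeal R)
    (hfl : IsFiniteLength R (R ⧸ t • (⊤ : Submodule R R)))
    (P : Submodule R (R ⧸ t • (⊤ : Submodule R R)))
    (g : P →ₗ[R] (R ⧸ t • (⊤ : Submodule R R))) :
    ∃ h : (R ⧸ t • (⊤ : Submodule R R)) →ₗ[R] (R ⧸ t • (⊤ : Submodule R R)),
      h ∘ₗ P.subtype = g := by
  have htK : ∀ z : R ⧸ t • (⊤ : Submodule R R), t • z = 0 := by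
    intro z
    obtain ⟨z, rfl⟩ := Submodule.mkQ_surjective _ z
    rw [← map_smul, Submodule.mkQ_apply, Submodule.Quotient.mk_eq_zero]
    exact Submodule.smul_mem_pointwise_smul _ _ _ trivial
  obtain ⟨h, hh⟩ := exists_extend_of_subsingleton_ext_two P.shortComplex_shortExact
    (IsSMulRegular.smulShortComplex_shortExact (M := ModuleCat.of R R) ht)
    (subsingleton_ext_of_two_le hn ht htm hfl le_rfl (hfl.of_surjective P.mkQ_surjective))
    (fun e => by
      have h1 : e.comp (Ext.mk₀ (ModuleCat.smulShortComplex (ModuleCat.of R R) t).f) (add_zero 1)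
          = (t • e : Ext _ (ModuleCat.of R R) 1) := by
        rw [Ext.smul_eq_comp_mk₀]; rfl
      refine h1.trans ?_
      -- Multiplication by `t` on Ext may be computed in either variable, and `t` kills `R / t`.
      have h2 : t • 𝟙 (ModuleCat.of R (R ⧸ t • (⊤ : Submodule R R))) = 0 := by
        ext1
        refine LinearMap.ext fun z => htK z
      have h3 : t • e = (Ext.mk₀ (t • 𝟙 (ModuleCat.of R (R ⧸ t • (⊤ : Submodule R R))))).comp e
          (zero_add 1) := by
        rw [Ext.mk₀_smul, Ext.smul_comp, Ext.mk₀_id_comp]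
      rw [h3, h2]; simp; rfl)
    (fun f => by
      ext1
      refine LinearMap.ext fun z => ht (?_ : t • f.hom z = t • (0 : R))
      rw [smul_zero, ← map_smul]
      have : t • z = 0 := Subtype.ext (htK z.1)
      rw [this, map_zero]; rfl) (ModuleCat.ofHom g)
  exact ⟨h.hom, by rw [← ModuleCat.hom_ofHom g, ← hh]; rfl⟩

/-- If `t` is a regular element of the one-dimensional Gorenstein local ring `R`, then every
homomorphism from an ideal `L` to `R / t` that factors through `L / L ∩ t R` is the multiplication
by an element of `R`. -/
lemma exists_eq_mk_mul {n : ℕ}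
    (hn : HasInjectiveDimensionLE (ModuleCat.of R R) n)
    {t : R} (ht : IsSMulRegular R t) (htm : t ∈ maximalIdeal R)
    (hfl : IsFiniteLength R (R ⧸ t • (⊤ : Submodule R R)))
    (L : Ideal R) (f : L →ₗ[R] R ⧸ t • (⊤ : Submodule R R))
    (hf : ∀ x : L, (x : R) ∈ t • (⊤ : Submodule R R) → f x = 0) :
    ∃ r : R, ∀ x : L, f x = (t • (⊤ : Submodule R R)).mkQ (r * x) := by
  let p : L →ₗ[R] R ⧸ t • (⊤ : Submodule R R) := (t • (⊤ : Submodule R R)).mkQ ∘ₗ L.subtype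
  obtain ⟨f', hf'⟩ := p.exists_factor_rangeRestrict f
    fun x hx => hf x ((Submodule.Quotient.mk_eq_zero _).mp hx)
  obtain ⟨h, hh⟩ := exists_extend_quotient_smul_top hn ht htm hfl (LinearMap.range p) f'
  obtain ⟨r, hr⟩ := Submodule.mkQ_surjective _ (h ((t • (⊤ : Submodule R R)).mkQ 1))
  refine ⟨r, fun x => ?_⟩
  have h3 : h (p x) = f x := (LinearMap.congr_fun hh (p.rangeRestrict x)).trans (hf' x)
  rw [← h3]
  have h4 : p x = (x : R) • (t • (⊤ : Submodule R R)).mkQ 1 := by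
    rw [← map_smul, smul_eq_mul, mul_one]; rfl
  rw [h4, map_smul, ← hr, ← map_smul, smul_eq_mul, mul_comm]

end ExtVanishing

section SimpleSocle

variable {A : Type u} [CommRing A] [IsLocalRing A] {K : Type u} [AddCommGroup K] [Module A K]

/-- If `t` is `K`-regular and `Ext ^ 1 (k, K)` has length one, then the socle of `K / t K` is
cyclic. -/
lemma exists_smul_sub_mem_of_length_ext_one
    (hK : Module.length A (Ext (ModuleCat.of A (ResidueField A)) (ModuleCat.of A K) 1) = 1)
    {t : A} (ht : IsSMulRegular K t) (htm : t ∈ maximalIdeal A) {z z' : K}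
    (hz : ∀ c ∈ maximalIdeal A, c • z ∈ t • (⊤ : Submodule A K))
    (hz' : ∀ c ∈ maximalIdeal A, c • z' ∈ t • (⊤ : Submodule A K))
    (hz0 : z ∉ t • (⊤ : Submodule A K)) :
    ∃ l : A, z' - l • z ∈ t • (⊤ : Submodule A K) := by
  have hT := IsSMulRegular.smulShortComplex_shortExact (M := ModuleCat.of A K) ht
  have hsimple := Module.length_eq_one_iff.mp hK
  have mk : ∀ w : K, (∀ c ∈ maximalIdeal A, c • w ∈ t • (⊤ : Submodule A K)) →
      ∃ f : ModuleCat.of A (ResidueField A) ⟶ (ModuleCat.smulShortComplex (ModuleCat.of A K) t).X₃,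
        f.hom (residue A 1) = (t • (⊤ : Submodule A K)).mkQ w := by
    intro w hw
    refine ⟨ModuleCat.ofHom ((maximalIdeal A).liftQ
      (LinearMap.toSpanSingleton A _ ((t • (⊤ : Submodule A K)).mkQ w)) ?_), ?_⟩
    · intro c hc
      rw [LinearMap.mem_ker, LinearMap.toSpanSingleton_apply, ← map_smul, Submodule.mkQ_apply,
        Submodule.Quotient.mk_eq_zero]
      exact hw c hc
    · exact one_smul A ((t • (⊤ : Submodule A K)).mkQ w)
  obtain ⟨f, hf⟩ := mk z hz
  obtain ⟨f', hf'⟩ := mk z' hz'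
  -- `Hom(k, K) = 0` because `t` kills `k` and is `K`-regular; hence `Hom(k, K / tK)` embeds in the
  -- simple module `Ext¹(k, K)`.
  have inj : ∀ q : ModuleCat.of A (ResidueField A) ⟶
      (ModuleCat.smulShortComplex (ModuleCat.of A K) t).X₃,
      (Ext.mk₀ q).comp hT.extClass (zero_add 1) = 0 → q = 0 := by
    intro q hq
    obtain ⟨x, hx⟩ := Ext.covariant_sequence_exact₃ _ hT _ (zero_add 1) hq
    obtain ⟨x, rfl⟩ := (Ext.mk₀_bijective _ _).2 x
    have hx0 : x = 0 := by
      ext1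
      refine LinearMap.ext fun y => (ht : Function.Injective fun w : K => t • w)
        (?_ : t • (show K from x.hom y) = t • (0 : K))
      rw [smul_zero]
      refine (map_smul x.hom t y).symm.trans ?_
      obtain ⟨y, rfl⟩ := residue_surjective y
      have : t • (residue A y : ResidueField A) = 0 := by
        have : algebraMap A (ResidueField A) t = 0 := (residue_eq_zero_iff t).mpr htm
        rw [Algebra.smul_def, this, zero_mul]
      erw [this, map_zero]; rfl
    rw [hx0, Ext.mk₀_zero, Ext.zero_comp] at hx
    exact (Ext.mk₀_bijective _ _).1 (by rw [← hx, Ext.mk₀_zero])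
  have hne : (Ext.mk₀ f).comp hT.extClass (zero_add 1) ≠ 0 := by
    intro h0
    have h1 := inj f h0
    rw [h1] at hf
    exact hz0 ((Submodule.Quotient.mk_eq_zero _).mp hf.symm)
  obtain ⟨l, hl⟩ := (isSimpleModule_iff_toSpanSingleton_surjective.mp hsimple).2 _ hne
    ((Ext.mk₀ f').comp hT.extClass (zero_add 1))
  refine ⟨l, ?_⟩
  have h0 : (Ext.mk₀ (f' - l • f)).comp hT.extClass (zero_add 1) = 0 := by
    rw [sub_eq_add_neg, Ext.mk₀_add, Ext.mk₀_neg, Ext.mk₀_smul, Ext.add_comp, Ext.neg_comp,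
      Ext.smul_comp]
    have hl' : l • (Ext.mk₀ f).comp hT.extClass (zero_add 1) =
      (Ext.mk₀ f').comp hT.extClass (zero_add 1) := hl
    rw [← hl']; exact add_neg_cancel _
  have h1 := congrArg (fun q => q.hom (residue A 1)) (inj _ h0)
  have h2 : f'.hom (residue A 1) - l • f.hom (residue A 1) = 0 := h1
  rw [hf, hf'] at h2
  exact (Submodule.Quotient.mk_eq_zero _).mp h2

end SimpleSocle

end ExtGroups

/-! ### Duality over the Artinian self-injective quotients `R / t`. -/

section QuotientsByRegularElements

open Pointwise

variable {R : Type*} [CommRing R] [IsLocalRing R]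

lemma IsLocalRing.isUnit_of_not_mem_maximalIdeal {c : R} (h : c ∉ maximalIdeal R) : IsUnit c := by
  by_contra h'
  exact h ((mem_maximalIdeal c).mpr h')

/-- Nakayama's lemma, in the form used for ideals. -/
lemma Ideal.le_of_le_sup_maximalIdeal_mul [IsNoetherianRing R] {L L' : Ideal R}
    (h : L' ≤ L ⊔ maximalIdeal R * L') : L' ≤ L :=
  Submodule.le_of_le_smul_of_le_jacobson_bot (IsNoetherian.noetherian L')
    (maximalIdeal_le_jacobson ⊥) h

/-- If `Q / P` is killed by a power of the maximal ideal and non-zero, then it has non-zero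
socle. -/
lemma exists_mem_socle {P Q : Ideal R} {n : ℕ} (hn : maximalIdeal R ^ n ≤ P) (hQ : ¬ Q ≤ P) :
    ∃ q ∈ Q, q ∉ P ∧ ∀ c ∈ maximalIdeal R, c * q ∈ P := by
  -- This weaker bound passes from `Q` to `𝔪Q` with `n` lowered by one.
  replace hn : maximalIdeal R ^ n * Q ≤ P := Ideal.mul_le_left.trans hn
  induction n generalizing Q with
  | zero => exact absurd (by simpa using hn) hQ
  | succ n ih =>
    by_cases h : maximalIdeal R * Q ≤ P
    · obtain ⟨q, hq, hqP⟩ := SetLike.not_le_iff_exists.mp hQ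
      exact ⟨q, hq, hqP, fun c hc => h (Ideal.mul_mem_mul hc hq)⟩
    · obtain ⟨q, hq, h1⟩ := ih h (by rwa [← mul_assoc, ← pow_succ])
      exact ⟨q, Ideal.mul_le_right hq, h1⟩

/-- An ideal is closed in the `t`-adic topology. -/
lemma Ideal.mem_of_forall_mem_sup_pow [IsNoetherianRing R] {t : R} {L : Ideal R} (htm : t ∈ maximalIdeal R) {x : R}
    (h : ∀ n, x ∈ L ⊔ Ideal.span {t ^ (n + 1)}) : x ∈ L := by
  have h1 := Ideal.iInf_pow_smul_eq_bot_of_isLocalRing (M := R ⧸ L) (maximalIdeal R)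
    (maximalIdeal.isMaximal R).ne_top
  have h2 : Ideal.Quotient.mk L x ∈ ⨅ i, maximalIdeal R ^ i • (⊤ : Submodule R (R ⧸ L)) := by
    rw [Submodule.mem_iInf]
    intro n
    obtain ⟨l, hl, y, hy, rfl⟩ := Submodule.mem_sup.mp (h n)
    obtain ⟨a, rfl⟩ := Ideal.mem_span_singleton'.mp hy
    have : Ideal.Quotient.mk L (l + a * t ^ (n + 1)) =
        (a * t ^ (n + 1)) • (Ideal.Quotient.mk L 1) := by
      rw [map_add, Ideal.Quotient.eq_zero_iff_mem.mpr hl, zero_add, Algebra.smul_def]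
      simp
    rw [this]
    refine Submodule.smul_mem_smul (Ideal.mul_mem_left _ _ ?_) trivial
    exact Ideal.pow_le_pow_right n.le_succ (Ideal.pow_mem_pow htm (n + 1))
  rw [h1, Submodule.mem_bot] at h2
  exact Ideal.Quotient.eq_zero_iff_mem.mp h2

variable (R) in
/-- The properties of a one-dimensional Gorenstein local ring `R` used below: modulo a regular
element `t` of the maximal ideal, `R` is an Artinian self-injective ring. -/
structure HasArtinianSelfInjectiveQuotients : Prop where
  exists_pow_le : ∀ t ∈ maximalIdeal R, IsSMulRegular R t →
    ∃ n, maximalIdeal R ^ n ≤ Ideal.span {t}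
  exists_eq_mul : ∀ t ∈ maximalIdeal R, IsSMulRegular R t → ∀ (L : Ideal R)
    (f : L →ₗ[R] R ⧸ t • (⊤ : Submodule R R)), (∀ x : L, t ∣ (x : R) → f x = 0) →
    ∃ r : R, ∀ x : L, f x = (t • (⊤ : Submodule R R)).mkQ (r * x)

omit [IsLocalRing R] in
lemma mkQ_smul_top_eq_zero_iff {t a : R} :
    (t • (⊤ : Submodule R R)).mkQ a = 0 ↔ t ∣ a := by
  rw [Submodule.mkQ_apply, Submodule.Quotient.mk_eq_zero,
    Submodule.mem_smul_pointwise_iff_exists]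
  exact ⟨fun ⟨y, _, hy⟩ => ⟨y, hy.symm⟩, fun ⟨y, hy⟩ => ⟨y, trivial, hy.symm⟩⟩

namespace HasArtinianSelfInjectiveQuotients

variable (hR : HasArtinianSelfInjectiveQuotients R)
include hR

variable {t : R} (htm : t ∈ maximalIdeal R) (ht : IsSMulRegular R t)
include htm ht

lemma exists_socle_generator :
    ∃ s : R, ¬ t ∣ s ∧ ∀ c ∈ maximalIdeal R, t ∣ c * s := by
  obtain ⟨n, hn⟩ := hR.exists_pow_le t htm ht
  obtain ⟨s, -, h1, h2⟩ := exists_mem_socle (Q := ⊤) hn (fun h =>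
    (maximalIdeal.isMaximal R).ne_top (top_le_iff.mp (h.trans
      ((Ideal.span_singleton_le_iff_mem _).mpr htm))))
  exact ⟨s, by rwa [Ideal.mem_span_singleton] at h1,
    fun c hc => Ideal.mem_span_singleton.mp (h2 c hc)⟩

/-- Every ideal of `R / t` is the annihilator of its annihilator. -/
lemma mem_of_forall_dvd {L : Ideal R} (htL : t ∈ L) {x : R}
    (h : ∀ r, (∀ y ∈ L, t ∣ r * y) → t ∣ r * x) : x ∈ L := by
  by_contra hx
  obtain ⟨n, hn⟩ := hR.exists_pow_le t htm ht
  obtain ⟨s, hs, hsm⟩ := hR.exists_socle_generator htm ht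
  obtain ⟨q, hq, hqL, hqm⟩ := exists_mem_socle (Q := Ideal.span {x})
    (hn.trans ((Ideal.span_singleton_le_iff_mem _).mpr htL))
    (fun h => hx ((Ideal.span_singleton_le_iff_mem _).mp h))
  obtain ⟨c, rfl⟩ := Ideal.mem_span_singleton'.mp hq
  -- With `q = c * x` in the socle modulo `L`, there is a map on `L + Rq` killing `L` and sending
  -- `q` to the socle element `s` of `R / t`. Self-injectivity makes it multiplication by some `r`,
  -- which kills `L` modulo `t` but not `q`.
  let p : R × L →ₗ[R] R := (LinearMap.toSpanSingleton R R (c * x)).coprod L.subtype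
  let g : R × L →ₗ[R] R ⧸ t • (⊤ : Submodule R R) :=
    (LinearMap.toSpanSingleton R _ ((t • (⊤ : Submodule R R)).mkQ s)) ∘ₗ LinearMap.fst R R L
  have hp : ∀ a l, p (a, l) = a * (c * x) + l := fun a l => rfl
  have hg : ∀ a l, g (a, l) = (t • (⊤ : Submodule R R)).mkQ (a * s) := fun a l => rfl
  have hkey : ∀ a (l : L), a * (c * x) + l ∈ L → t ∣ a * s := by
    intro a l hal
    refine hsm a ?_
    by_contra ha
    obtain ⟨u, rfl⟩ := isUnit_of_not_mem_maximalIdeal ha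
    have := (Submodule.add_mem_iff_left L l.2).mp hal
    exact hqL ((Ideal.unit_mul_mem_iff_mem L u.isUnit).mp this)
  obtain ⟨f, hf⟩ := p.exists_factor_rangeRestrict g (by
    rintro ⟨a, l⟩ h0
    rw [LinearMap.mem_ker, hp] at h0
    rw [LinearMap.mem_ker, hg, mkQ_smul_top_eq_zero_iff]
    exact hkey a l (h0 ▸ L.zero_mem))
  obtain ⟨r, hr⟩ := hR.exists_eq_mul t htm ht (LinearMap.range p) f (by
    rintro ⟨_, ⟨a, l⟩, rfl⟩ hdvd
    refine (hf (a, l)).trans ?_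
    rw [hg, mkQ_smul_top_eq_zero_iff]
    exact hkey a l (L.mem_of_dvd hdvd htL))
  have hr' : ∀ a (l : L), t ∣ a * s - r * (a * (c * x) + l) := by
    intro a l
    rw [← mkQ_smul_top_eq_zero_iff, map_sub, sub_eq_zero]
    exact (hf (a, l)).symm.trans (hr _)
  have h1 : t ∣ r * x := h r fun y hy => by
    have := hr' 0 ⟨y, hy⟩
    simpa using this
  refine hs ?_
  have h2 := hr' 1 0
  have h3 : s = (1 * s - r * (1 * (c * x) + ((0 : L) : R))) + c * (r * x) := by simp; ring
  rw [h3]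
  exact dvd_add h2 (Dvd.dvd.mul_left h1 c)

/-- The socle of `R / t` is contained in every non-zero ideal. -/
lemma mem_span_pair_of_socle {s : R} (hs : ¬ t ∣ s)
    {a : R} (ha : ∀ c ∈ maximalIdeal R, t ∣ c * a) : a ∈ Ideal.span {s, t} := by
  refine hR.mem_of_forall_dvd htm ht (Ideal.subset_span (by simp)) fun r hr => ha r ?_
  by_contra h
  obtain ⟨u, rfl⟩ := isUnit_of_not_mem_maximalIdeal h
  exact hs ((Units.dvd_mul_left).mp (hr s (Ideal.subset_span (by simp))))

variable [IsNoetherianRing R]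

/-- If `R / L` is torsion-free, then `Ext ^ 1 (R / L, R) = 0`. -/
lemma exists_forall_eq_mul {L : Ideal R} (hL : ∀ x, t * x ∈ L → x ∈ L) (f : L →ₗ[R] R) :
    ∃ r : R, ∀ x : L, f x = r * x := by
  let N : Submodule R (L →ₗ[R] R) := LinearMap.range (LinearMap.toSpanSingleton R _ L.subtype)
  -- Nakayama in `Hom(L, R)`: it is enough to write `f` as a multiplication plus `t` times a
  -- homomorphism. Modulo `t` this is self-injectivity, since `L ∩ tR = tL`.
  suffices h : (⊤ : Submodule R (L →ₗ[R] R)) ≤ N by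
    obtain ⟨r, hr⟩ := h (Submodule.mem_top (x := f))
    exact ⟨r, fun x => (LinearMap.congr_fun hr x).symm⟩
  refine Submodule.le_of_le_smul_of_le_jacobson_bot (I := maximalIdeal R)
    Module.Finite.fg_top (maximalIdeal_le_jacobson ⊥) ?_
  intro f _
  obtain ⟨r, hr⟩ := hR.exists_eq_mul t htm ht L ((t • (⊤ : Submodule R R)).mkQ ∘ₗ f) (by
    rintro ⟨x, hx⟩ ⟨y, hy⟩
    dsimp only at hy
    subst hy
    rw [LinearMap.comp_apply, mkQ_smul_top_eq_zero_iff]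
    refine ⟨f ⟨y, hL y hx⟩, ?_⟩
    have : (⟨t * y, hx⟩ : L) = t • ⟨y, hL y hx⟩ := rfl
    rw [this, map_smul, smul_eq_mul])
  have hr' : ∀ x : L, ∃ z, f x - r * x = t * z := by
    intro x
    have := hr x
    rw [LinearMap.comp_apply, ← sub_eq_zero, ← map_sub, mkQ_smul_top_eq_zero_iff] at this
    exact this
  choose g hg using hr'
  let g' : L →ₗ[R] R :=
    { toFun := g
      map_add' := fun x y => ht (by
        simp only [smul_eq_mul, mul_add, ← hg, map_add, Submodule.coe_add]; ring)
      map_smul' := fun a x => ht (by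
        simp only [smul_eq_mul, RingHom.id_apply, mul_left_comm t a, ← hg, map_smul,
          Submodule.coe_smul]; ring) }
  refine Submodule.mem_sup.mpr ⟨r • L.subtype, ⟨r, rfl⟩, t • g',
    Submodule.smul_mem_smul htm trivial, ?_⟩
  ext x
  have : t * g x = f x - r * x := (hg x).symm
  simp only [LinearMap.add_apply, LinearMap.smul_apply, smul_eq_mul, Submodule.subtype_apply]
  change r * x + t * g x = f x
  rw [this]; ring

/-- The annihilator of `L` modulo `t` lifts to the annihilator of `L`. -/
lemma exists_sub_mul_mul_eq_zero {L : Ideal R} (hL : ∀ x, t * x ∈ L → x ∈ L) {r : R}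
    (hr : ∀ x ∈ L, t ∣ r * x) : ∃ r', ∀ x ∈ L, (r - t * r') * x = 0 := by
  choose g hg using fun x : L => hr x x.2
  let g' : L →ₗ[R] R :=
    { toFun := g
      map_add' := fun x y => ht (by
        simp only [smul_eq_mul, mul_add, ← hg, Submodule.coe_add])
      map_smul' := fun a x => ht (by
        simp only [smul_eq_mul, RingHom.id_apply, mul_left_comm t a, ← hg,
          Submodule.coe_smul]; ring) }
  obtain ⟨r', hr'⟩ := hR.exists_forall_eq_mul htm ht hL g'
  refine ⟨r', fun x hx => ?_⟩
  have h1 : r * x = t * g ⟨x, hx⟩ := hg ⟨x, hx⟩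
  have h2 : g ⟨x, hx⟩ = r' * x := hr' ⟨x, hx⟩
  rw [h2] at h1
  rw [sub_mul, h1]; ring

/-- If `R / L` is torsion-free, then `L` is the annihilator of its annihilator. -/
lemma mem_of_forall_mul_eq_zero {L : Ideal R} (hL : ∀ x, t * x ∈ L → x ∈ L) {x : R}
    (hx : ∀ r, (∀ y ∈ L, r * y = 0) → r * x = 0) : x ∈ L := by
  refine Ideal.mem_of_forall_mem_sup_pow htm fun n => ?_
  have hLn : ∀ n x, t ^ n * x ∈ L → x ∈ L := by
    intro n
    induction n with
    | zero => intro x hx; simpa using hx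
    | succ n ih => intro x hx; exact ih x (hL _ (by rwa [← mul_assoc, ← pow_succ']))
  have hm : t ^ (n + 1) ∈ maximalIdeal R := Ideal.pow_mem_of_mem _ htm _ n.succ_pos
  refine hR.mem_of_forall_dvd hm (ht.pow (n + 1))
    (Ideal.mem_sup_right (Ideal.mem_span_singleton_self _)) fun r hr => ?_
  -- An annihilator modulo `tⁿ⁺¹` lifts to a true annihilator of `L`, which kills `x` by hypothesis.
  obtain ⟨r', hr'⟩ := hR.exists_sub_mul_mul_eq_zero hm (ht.pow (n + 1)) (hLn (n + 1))
    (r := r) fun y hy => hr y (Ideal.mem_sup_left hy)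
  have := hx _ hr'
  exact ⟨r' * x, by linear_combination this⟩

end HasArtinianSelfInjectiveQuotients

end QuotientsByRegularElements

/-! ### The maximal ideal as a direct sum of principal ideals. -/

section SumOfIdeals

variable {R : Type*} [CommRing R] [IsLocalRing R] [IsNoetherianRing R]

/-- The properties of an ideal `𝔟` of the idealization `R ⋉ I`, given as a relation, for which
`𝔟 / t` is killed by the maximal ideal and `(R ⋉ I) / 𝔟` has cyclic socle. -/
structure IsSocleIdeal (t : R) (I : Ideal R) (B : R → R → Prop) : Prop where
  add {a x a' x'} : B a x → B a' x' → B (a + a') (x + x')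
  mul {a x} (c : R) {y} : y ∈ I → B a x → B (c * a) (c * x + y * a)
  t_mul (a : R) {x} : x ∈ I → B (t * a) (t * x)
  dvd {a x} : B a x → ∀ c ∈ maximalIdeal R, t ∣ c * a ∧ t ∣ c * x
  dvd' {a x} : B a x → ∀ y ∈ I, t ∣ y * a
  cyclic {a x a' x'} : x ∈ I → x' ∈ I →
    (∀ c ∈ maximalIdeal R, ∀ y ∈ I, B (c * a) (c * x + y * a)) →
    (∀ c ∈ maximalIdeal R, ∀ y ∈ I, B (c * a') (c * x' + y * a')) → ¬ B a x →
    ∃ l, ∃ y ∈ I, B (a' - l * a) (x' - (l * x + y * a))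

/-- The heart of the matter: an ideal as in `IsSocleIdeal` forces the maximal ideal of `R` to be
the sum of `I` and its annihilator. -/
theorem maximalIdeal_le_sup_of_isSocleIdeal (hR : HasArtinianSelfInjectiveQuotients R)
    {t : R} (htm : t ∈ maximalIdeal R) (ht2 : t ∈ maximalIdeal R * maximalIdeal R)
    (ht : IsSMulRegular R t)
    {I J : Ideal R} (hI : I ≠ ⊥) (hIm : I ≤ maximalIdeal R) (hIt : ∀ x, t * x ∈ I → x ∈ I)
    (hJ : ∀ r, r ∈ J ↔ ∀ x ∈ I, r * x = 0) {B : R → R → Prop} (hB : IsSocleIdeal t I B) :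
    maximalIdeal R ≤ I ⊔ J := by
  have reg : ∀ {a b : R}, t * a = t * b → a = b := fun h => ht h
  have hJt : ∀ x, t * x ∈ J → x ∈ J := by
    intro x hx
    rw [hJ] at hx ⊢
    intro y hy
    refine reg ?_
    rw [← mul_assoc, hx y hy, mul_zero]
  obtain ⟨n, hn⟩ := hR.exists_pow_le t htm ht
  have hIn : ¬ I ≤ Ideal.span {t} := by
    intro h
    refine hI (le_bot_iff.mp (Ideal.le_of_le_sup_maximalIdeal_mul (fun x hx => ?_)))
    obtain ⟨y, rfl⟩ := Ideal.mem_span_singleton.mp (h hx)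
    exact Ideal.mem_sup_right (Ideal.mul_mem_mul htm (hIt y hx))
  -- The socle of `R / t` is simple, so `s`, although chosen in `I`, generates all of it.
  obtain ⟨s, hsI, hst, hsm⟩ := exists_mem_socle hn hIn
  simp only [Ideal.mem_span_singleton] at hst hsm
  have htI : ∀ {r r' w : R}, w ∈ I → w = r * s + t * r' → r' ∈ I := by
    intro r r' w hw h
    refine hIt _ ?_
    have : t * r' = w - r * s := by rw [h]; ring
    rw [this]
    exact I.sub_mem hw (I.mul_mem_left _ hsI)
  have hsoc : ∀ {a}, (∀ c ∈ maximalIdeal R, t ∣ c * a) → ∃ r r', a = r * s + t * r' := by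
    intro a ha
    obtain ⟨r, r', h⟩ := Ideal.mem_span_pair.mp (hR.mem_span_pair_of_socle htm ht hst ha)
    exact ⟨r, r', by rw [← h]; ring⟩
  have hspan : Ideal.span {t} ≤ Ideal.span {s, t} := Ideal.span_mono (by simp)
  have hmem : ∀ {a}, a ∈ Ideal.span {s, t} ↔ ∃ r r', a = r * s + t * r' := by
    intro a
    rw [Ideal.mem_span_pair]
    exact ⟨fun ⟨r, r', h⟩ => ⟨r, r', by rw [← h]; ring⟩,
      fun ⟨r, r', h⟩ => ⟨r, r', by rw [h]; ring⟩⟩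
  have Bcongr : ∀ {a x a' x'}, B a x → a = a' → x = x' → B a' x' := by
    rintro a x _ _ h rfl rfl; exact h
  by_cases hs : B 0 s
  · exfalso
    -- The trace on `R` of the ideal of the idealization. It is proper: otherwise `𝔪 ⊆ tR ⊆ 𝔪²`, so
    -- `𝔪 = 0`.
    let P : Ideal R :=
      { carrier := {a | B a 0}
        add_mem' := fun h h' => Bcongr (hB.add h h') rfl (by ring)
        zero_mem' := Bcongr (hB.t_mul 0 I.zero_mem) (by ring) (by ring)
        smul_mem' := fun c x h => Bcongr (hB.mul c I.zero_mem h) rfl (by ring) }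
    have hPt : Ideal.span {t} ≤ P := (Ideal.span_singleton_le_iff_mem _).mpr
      (Bcongr (hB.t_mul 1 I.zero_mem) (by ring) (by ring) : B t 0)
    have hP : ¬ ⊤ ≤ P := by
      intro h
      have h1 : B 1 0 := h (Submodule.mem_top (x := (1 : R)))
      have h2 : maximalIdeal R ≤ ⊥ := by
        refine Ideal.le_of_le_sup_maximalIdeal_mul fun c hc => Ideal.mem_sup_right ?_
        obtain ⟨d, hd⟩ := (hB.dvd h1 c hc).1
        rw [mul_one] at hd
        rw [hd]
        exact Ideal.mul_mem_right _ _ ht2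
      have : t = 0 := h2 htm
      exact hst (this ▸ (h2 (hIm hsI) : s = 0) ▸ dvd_rfl)
    obtain ⟨a, -, haP, ham⟩ := exists_mem_socle (hn.trans hPt) hP
    -- Hence `(a, 0)` represents a non-zero socle element of the quotient by `B`, and cyclicity can
    -- be tested against it.
    have hIa : ∀ y ∈ I, B 0 (y * a) := by
      intro y hy
      obtain ⟨r, r', h⟩ := hsoc (a := y * a) (fun c hc => by
        have := hB.dvd' (ham c hc) y hy
        rwa [mul_left_comm] at this)
      have hr' := htI (I.mul_mem_right a hy) h
      exact Bcongr (hB.add (hB.mul r I.zero_mem hs) (hB.t_mul 0 hr')) (by ring) (by rw [h]; ring)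
    -- A socle element `x` of `I` modulo `(s, t)` gives `(0, x)` in the socle of the quotient by
    -- `B`. Subtracting a multiple of `(a, 0)` lands in `B`, which forces `𝔪x ⊆ tR` and so `x ∈ (s,
    -- t)`.
    have h1 : I ≤ Ideal.span {s, t} := by
      by_contra hc
      obtain ⟨x, hxI, hx, hxm⟩ := exists_mem_socle (hn.trans hspan) hc
      obtain ⟨l, y, hy, h⟩ := hB.cyclic (a := a) (x := 0) (a' := 0) (x' := x) I.zero_mem hxI
        (fun c hc y hy => Bcongr (hB.add (ham c hc) (hIa y hy)) (by ring) (by ring))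
        (fun c hc y hy => by
          obtain ⟨r, r', h⟩ := hmem.mp (hxm c hc)
          have hr' := htI (I.mul_mem_left c hxI) h
          exact Bcongr (hB.add (hB.mul r I.zero_mem hs) (hB.t_mul 0 hr')) (by ring)
            (by rw [h]; ring)) haP
      have h2 : B (0 - l * a) x := Bcongr (hB.add h (hIa y hy)) (by ring) (by ring)
      exact hx (hmem.mpr (hsoc fun c hc => (hB.dvd h2 c hc).2))
    have h2 : I ≤ Ideal.span {s} := by
      refine Ideal.le_of_le_sup_maximalIdeal_mul fun x hx => ?_
      obtain ⟨r, r', h⟩ := hmem.mp (h1 hx)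
      rw [h]
      exact Submodule.add_mem_sup (Ideal.mul_mem_left _ _ (Ideal.mem_span_singleton_self s))
        (Ideal.mul_mem_mul htm (htI hx h))
    -- Since `I = (s)`, each `c ∈ 𝔪` has `cs = tds` for some `d`; then `c - td` kills `I`, and `td ∈
    -- 𝔪²` is absorbed by Nakayama.
    have h3 : maximalIdeal R ≤ J := by
      refine Ideal.le_of_le_sup_maximalIdeal_mul fun c hc => ?_
      obtain ⟨z, hz⟩ := hsm c hc
      have hzI : z ∈ I := hIt z (hz ▸ I.mul_mem_left c hsI)
      obtain ⟨d, rfl⟩ := Ideal.mem_span_singleton.mp (h2 hzI)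
      have : c = (c - t * d) + t * d := by ring
      rw [this]
      refine Submodule.add_mem_sup ((hJ _).mpr fun x hx => ?_) (Ideal.mul_mem_right _ _ ht2)
      obtain ⟨e, rfl⟩ := Ideal.mem_span_singleton.mp (h2 hx)
      linear_combination e * hz
    have h4 : s = 0 := reg (((hJ t).mp (h3 htm) s hsI).trans (mul_zero t).symm)
    exact hst (h4 ▸ dvd_zero t)
  · have hsB : ∀ c ∈ maximalIdeal R, ∃ z ∈ I, c * s = t * z := by
      intro c hc
      obtain ⟨z, hz⟩ := hsm c hc
      exact ⟨z, hIt z (hz ▸ I.mul_mem_left c hsI), hz⟩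
    have hE : ∀ c ∈ maximalIdeal R, ∀ y ∈ I, B (c * 0) (c * s + y * 0) := by
      intro c hc y _
      obtain ⟨z, hz, h⟩ := hsB c hc
      exact Bcongr (hB.t_mul 0 hz) (by ring) (by rw [h]; ring)
    -- Both `(0, s)` and `(s, 0)` are socle elements modulo `B`, and `(0, s)` is non-zero there; so
    -- `(s, us) ∈ B` for some `u`.
    obtain ⟨l, y₀, hy₀, hl⟩ := hB.cyclic (a := 0) (x := s) (a' := s) (x' := 0) hsI I.zero_mem hE
      (fun c hc y hy => by
        obtain ⟨z, hz, h⟩ := hsB c hc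
        obtain ⟨z', hz', h'⟩ := hsB y (hIm hy)
        exact Bcongr (hB.t_mul z hz') h.symm (by rw [h']; ring)) hs
    have hu : B s (-l * s) := Bcongr hl (by ring) (by ring)
    generalize -l = u at hu
    have h1 : I ⊓ (J ⊔ Ideal.span {t}) ≤ Ideal.span {s, t} := by
      by_contra hc
      obtain ⟨w, ⟨hwI, hwJ⟩, hw, hwm⟩ := exists_mem_socle (hn.trans hspan) hc
      obtain ⟨j, hj, _, hz, hjz⟩ := Submodule.mem_sup.mp hwJ
      obtain ⟨r, rfl⟩ := Ideal.mem_span_singleton.mp hz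
      -- The second coordinate `u * w` matches `(s, us)`: multiplying by `c` gives a multiple of
      -- `(s, us)` modulo `t`. The term `y * w` is divisible by `t` because `J` kills `y`. Multiples
      -- of `(0, s)` have first coordinate zero, so `(w, _) ∈ B`.
      obtain ⟨l', y', hy', h⟩ := hB.cyclic (a := 0) (x := s) (a' := w) (x' := u * w) hsI
        (I.mul_mem_left u hwI) hE (fun c hc y hy => by
          obtain ⟨e, r', h⟩ := hmem.mp (hwm c hc)
          have hr' := htI (I.mul_mem_left c hwI) h
          have hyj : j * y = 0 := (hJ j).mp hj y hy
          refine Bcongr (hB.add (hB.mul e I.zero_mem hu) (hB.t_mul r'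
            (I.add_mem (I.mul_mem_left u hr') (I.mul_mem_right r hy)))) h.symm ?_
          linear_combination (-u) * h - hyj + y * hjz) hs
      refine hw (hmem.mpr (hsoc fun c hc => ?_))
      have := (hB.dvd h c hc).1
      rwa [mul_zero, sub_zero] at this
    -- An `r` killing `I + J` modulo `t` lifts to `J = 0 : I` and to `I = 0 : J`. So it lies in `(s,
    -- t)` and kills `𝔪` modulo `t`; now use double annihilators.
    have h2 : maximalIdeal R ≤ I ⊔ J ⊔ Ideal.span {t} := by
      intro x hx
      refine hR.mem_of_forall_dvd htm ht
        (Ideal.mem_sup_right (Ideal.mem_span_singleton_self t)) fun r hr => ?_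
      obtain ⟨r₁, hr₁⟩ := hR.exists_sub_mul_mul_eq_zero htm ht hIt (r := r)
        fun y hy => hr y (Ideal.mem_sup_left (Ideal.mem_sup_left hy))
      obtain ⟨r₂, hr₂⟩ := hR.exists_sub_mul_mul_eq_zero htm ht hJt (r := r)
        fun y hy => hr y (Ideal.mem_sup_left (Ideal.mem_sup_right hy))
      have hwI : r - t * r₂ ∈ I := hR.mem_of_forall_mul_eq_zero htm ht hIt fun q hq => by
        rw [mul_comm]
        exact hr₂ q ((hJ q).mpr hq)
      have hwJ : r - t * r₂ ∈ J ⊔ Ideal.span {t} := by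
        have : r - t * r₂ = (r - t * r₁) + t * (r₁ - r₂) := by ring
        rw [this]
        exact Submodule.add_mem_sup ((hJ _).mpr hr₁)
          (Ideal.mul_mem_right _ _ (Ideal.mem_span_singleton_self t))
      obtain ⟨e, e', h⟩ := hmem.mp (h1 ⟨hwI, hwJ⟩)
      obtain ⟨d, hd⟩ := hsm x hx
      exact ⟨e * d + (e' + r₂) * x, by linear_combination x * h + e * hd⟩
    refine Ideal.le_of_le_sup_maximalIdeal_mul (h2.trans (sup_le_sup_left ?_ _))
    exact (Ideal.span_singleton_le_iff_mem _).mpr ht2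

omit [IsNoetherianRing R] in
/-- If the maximal ideal of a ring as above is the direct sum of two non-zero ideals `I` and `J`,
then `I` is principal. -/
theorem exists_eq_span_singleton_of_sup_eq (hR : HasArtinianSelfInjectiveQuotients R)
    {t : R} (htm : t ∈ maximalIdeal R) (ht : IsSMulRegular R t)
    {I J : Ideal R} (hI : I ≠ ⊥) (hJ : J ≠ ⊥) (hsup : I ⊔ J = maximalIdeal R)
    (hinf : I ⊓ J = ⊥) : ∃ x, I = Ideal.span {x} := by
  have reg : ∀ {a : R}, t * a = 0 → a = 0 := fun {a} h => ht (by simpa using h)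
  have hIJ : ∀ x ∈ I, ∀ y ∈ J, x * y = 0 := fun x hx y hy =>
    (Submodule.mem_bot R).mp (hinf ▸ ⟨I.mul_mem_right _ hx, J.mul_mem_left _ hy⟩)
  have hinf' : ∀ z ∈ I, z ∈ J → z = 0 := fun z hz hz' =>
    (Submodule.mem_bot R).mp (hinf ▸ ⟨hz, hz'⟩)
  have hsup' : ∀ {c}, c ∈ maximalIdeal R → ∃ a ∈ I, ∃ b ∈ J, a + b = c := fun hc =>
    Submodule.mem_sup.mp (hsup ▸ hc)
  obtain ⟨i, hi, j, hj, hij⟩ := hsup' htm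
  have hti : ∀ x ∈ I, t * x = i * x := fun x hx => by
    rw [← hij, add_mul, mul_comm j, hIJ x hx j hj, add_zero]
  obtain ⟨n, hn⟩ := hR.exists_pow_le t htm ht
  -- If `i = tr`, then `j = t(1 - r)`, and one of `r`, `1 - r` is a unit. So `t` kills `J` or `I`,
  -- contradicting regularity.
  have hitm : ¬ t ∣ i := by
    rintro ⟨r, hr⟩
    by_cases h : r ∈ maximalIdeal R
    · have h1 : IsUnit (1 - r) := by
        by_contra h'
        exact (maximalIdeal.isMaximal R).ne_top ((Ideal.eq_top_iff_one _).mpr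
          (by simpa using add_mem h ((mem_maximalIdeal _).mpr h')))
      have hjt : j = t * (1 - r) := by linear_combination hij - hr
      obtain ⟨x, hx, hx0⟩ := Submodule.exists_mem_ne_zero_of_ne_bot hI
      refine hx0 (reg (h1.mul_left_eq_zero.mp ?_))
      rw [mul_right_comm, ← hjt, mul_comm]
      exact hIJ x hx j hj
    · have h1 := isUnit_of_not_mem_maximalIdeal h
      obtain ⟨x, hx, hx0⟩ := Submodule.exists_mem_ne_zero_of_ne_bot hJ
      refine hx0 (reg (h1.mul_left_eq_zero.mp ?_))
      rw [mul_right_comm, ← hr]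
      exact hIJ i hi x hx
  have htiJ : Ideal.span {t} ≤ Ideal.span {i} ⊔ J := (Ideal.span_singleton_le_iff_mem _).mpr
    (hij ▸ Submodule.add_mem_sup (Ideal.mem_span_singleton_self i) hj)
  have hne : ¬ ⊤ ≤ Ideal.span {i} ⊔ J := fun h => (maximalIdeal.isMaximal R).ne_top
    (top_le_iff.mp (h.trans (hsup ▸ sup_le_sup_right
      ((Ideal.span_singleton_le_iff_mem _).mpr hi) J)))
  have hmod : ∀ z ∈ I, z ∈ Ideal.span {i} ⊔ J → z ∈ Ideal.span {i} := by
    intro z hz h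
    obtain ⟨a, ha, b, hb, rfl⟩ := Submodule.mem_sup.mp h
    have : b = 0 := hinf' b ((Submodule.add_mem_iff_right I
      ((Ideal.span_singleton_le_iff_mem _).mpr hi ha)).mp hz) hb
    rwa [this, add_zero]
  obtain ⟨w, -, hw, hwm⟩ := exists_mem_socle (hn.trans htiJ) hne
  have hIm : I ≤ maximalIdeal R := hsup ▸ le_sup_left
  by_cases hwu : w ∈ maximalIdeal R
  · obtain ⟨w₁, hw₁, j₁, hj₁, rfl⟩ := hsup' hwu
    have hwI : ∀ x ∈ I, w₁ * x ∈ Ideal.span {i} := by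
      intro x hx
      have h1 := hwm x (hIm hx)
      rw [mul_add, hIJ x hx j₁ hj₁, add_zero, mul_comm] at h1
      exact hmod _ (I.mul_mem_left _ hx) h1
    -- Otherwise `w₁I ⊆ i𝔪 = iI = tI`, so `w₁` is in the socle of `R / t` and lies in `(i, t) ⊆ (i)
    -- + J`, against the choice of `w`.
    obtain ⟨x, hx, r, hr, hwx⟩ : ∃ x ∈ I, ∃ r, IsUnit r ∧ w₁ * x = i * r := by
      by_contra hcon
      push Not at hcon
      refine hw (add_mem (?_ : w₁ ∈ _) (Ideal.mem_sup_right hj₁))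
      have h2 : w₁ ∈ Ideal.span {i, t} := by
        refine hR.mem_span_pair_of_socle htm ht hitm fun c hc => ?_
        obtain ⟨a, ha, b, hb, rfl⟩ := hsup' hc
        obtain ⟨r, hr⟩ := Ideal.mem_span_singleton.mp (hwI a ha)
        by_cases hru : r ∈ maximalIdeal R
        · obtain ⟨r₁, hr₁, r₂, hr₂, rfl⟩ := hsup' hru
          refine ⟨r₁, ?_⟩
          rw [hti r₁ hr₁]
          linear_combination hr + hIJ w₁ hw₁ b hb + hIJ i hi r₂ hr₂
        · exact absurd hr (hcon a ha r (isUnit_of_not_mem_maximalIdeal hru))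
      obtain ⟨a, b, hab⟩ := Ideal.mem_span_pair.mp h2
      refine Ideal.mem_sup_left (hmod _ hw₁ ?_)
      have : w₁ = (a + b) * i + b * j := by rw [← hab, ← hij]; ring
      rw [this]
      exact Submodule.add_mem_sup (Ideal.mul_mem_left _ _ (Ideal.mem_span_singleton_self i))
        (J.mul_mem_left _ hj)
    refine ⟨x, le_antisymm (fun y hy => ?_) ((Ideal.span_singleton_le_iff_mem _).mpr hx)⟩
    obtain ⟨r', hr'⟩ := Ideal.mem_span_singleton.mp (hwI y hy)
    obtain ⟨q, hq⟩ := hr.exists_right_inv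
    have hzI : y - x * (q * r') ∈ I := I.sub_mem hy (I.mul_mem_right _ hx)
    -- On `I` the element `t` acts as `i`, and `i` is `w₁x` up to a unit; as `w₁` kills this
    -- difference, so does `t`.
    have hz : y - x * (q * r') = 0 := by
      refine reg ?_
      rw [hti _ hzI]
      refine hr.mul_left_eq_zero.mp ?_
      have : w₁ * (y - x * (q * r')) = 0 := by linear_combination hr' - q * r' * hwx - i * r' * hq
      linear_combination x * this - (y - x * (q * r')) * hwx
    rw [Ideal.mem_span_singleton]
    exact ⟨_, sub_eq_zero.mp hz⟩
  · refine ⟨i, le_antisymm (fun y hy => hmod y hy ?_)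
      ((Ideal.span_singleton_le_iff_mem _).mpr hi)⟩
    have := hwm y (hIm hy)
    rwa [Ideal.mul_unit_mem_iff_mem _ (isUnit_of_not_mem_maximalIdeal hwu)] at this

end SumOfIdeals

/-! ### Lengths, regular elements and Gorenstein rings in dimension one. -/

section DimensionOne

open Pointwise

/-- Nakayama's lemma, in the form used for modules. -/
lemma smul_top_eq_bot_of_le_pow {A : Type*} [CommRing A] [IsLocalRing A] [IsNoetherianRing A]
    {C : Type*} [AddCommGroup C] [Module A C] [Module.Finite A C] {n : ℕ}
    (h : maximalIdeal A • (⊤ : Submodule A C) ≤ maximalIdeal A ^ (n + 2) • ⊤) :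
    maximalIdeal A • (⊤ : Submodule A C) = ⊥ := by
  refine le_bot_iff.mp (Submodule.le_of_le_smul_of_le_jacobson_bot (I := maximalIdeal A)
    (IsNoetherian.noetherian _) (maximalIdeal_le_jacobson ⊥) ?_)
  rw [bot_sup_eq]
  refine h.trans ?_
  rw [pow_succ', Submodule.mul_smul]
  exact smul_mono_right _ (Submodule.smul_mono_left (Ideal.pow_le_self n.succ_ne_zero))

section Length

variable {A : Type*} [CommRing A] [IsLocalRing A] [IsNoetherianRing A]
  {C : Type*} [AddCommGroup C] [Module A C] [Module.Finite A C]

/-- The maximal ideal of `A / 𝔪ⁿ` is nilpotent, so this ring is Artinian. Finiteness ensures that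
`toNat` loses nothing in the multiplicity. -/
lemma isFiniteLength_quotient_pow_smul_top (n : ℕ) :
    IsFiniteLength A (C ⧸ (maximalIdeal A ^ n • (⊤ : Submodule A C))) := by
  rw [isFiniteLength_iff_isNoetherian_isArtinian]
  refine ⟨inferInstance, ?_⟩
  have hart : IsArtinianRing (A ⧸ maximalIdeal A ^ n) := by
    rcases subsingleton_or_nontrivial (A ⧸ maximalIdeal A ^ n) with h | h
    · infer_instance
    have := IsLocalRing.of_surjective' (Ideal.Quotient.mk (maximalIdeal A ^ n))
      Ideal.Quotient.mk_surjective
    have := IsLocalHom.of_surjective (Ideal.Quotient.mk (maximalIdeal A ^ n))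
      Ideal.Quotient.mk_surjective
    rw [isArtinianRing_iff_isNilpotent_maximalIdeal]
    refine ⟨n, le_bot_iff.mp ?_⟩
    have hle : maximalIdeal (A ⧸ maximalIdeal A ^ n) ≤
        (maximalIdeal A).map (Ideal.Quotient.mk (maximalIdeal A ^ n)) := by
      intro x hx
      obtain ⟨x, rfl⟩ := Ideal.Quotient.mk_surjective x
      exact Ideal.mem_map_of_mem _ (by simpa using hx)
    refine (Ideal.pow_right_mono hle n).trans ?_
    rw [← Ideal.map_pow, Ideal.map_quotient_self]
  have : Module.Finite (A ⧸ maximalIdeal A ^ n)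
      (C ⧸ (maximalIdeal A ^ n • (⊤ : Submodule A C))) :=
    Module.Finite.of_restrictScalars_finite A _ _
  exact isArtinian_of_surjective_algebraMap (R := A ⧸ maximalIdeal A ^ n)
    Ideal.Quotient.mk_surjective

/-- The length of `C / 𝔪 C` is the minimal number of generators of `C`. -/
lemma length_quotient_maximalIdeal_smul_top :
    Module.length A (C ⧸ (maximalIdeal A • (⊤ : Submodule A C))) = minGenerators A C := by
  rw [minGenerators, IsLocalRing.spanFinrank_eq_finrank_quotient (⊤ : Submodule A C)
    (IsNoetherian.noetherian _)]
  let : Field (A ⧸ maximalIdeal A) := Ideal.Quotient.field _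
  have : Module.Finite (A ⧸ maximalIdeal A)
      ((⊤ : Submodule A C) ⧸ (maximalIdeal A • (⊤ : Submodule A (⊤ : Submodule A C)))) :=
    Module.Finite.of_restrictScalars_finite A _ _
  rw [← Module.length_eq_finrank, ← Module.length_eq_of_surjective (S := A)
    Ideal.Quotient.mk_surjective]
  refine (Submodule.Quotient.equiv _ _ Submodule.topEquiv ?_).length_eq.symm
  rw [Submodule.map_smul'', Submodule.map_top, LinearEquiv.range]

/-- If the multiplicity of a module over a one-dimensional ring is its number of generators,
then the module is killed by the maximal ideal. -/
lemma HasMultiplicity.smul_eq_zero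
    (h : HasMultiplicity A 1 C (minGenerators A C)) {c : A} (hc : c ∈ maximalIdeal A) (z : C) :
    c • z = 0 := by
  -- Natural numbers at distance less than `1` from a natural number are equal to it.
  have h1 : ∀ᶠ n : ℕ in Filter.atTop,
      (Module.length A (C ⧸ (maximalIdeal A ^ (n + 1) • (⊤ : Submodule A C)))).toNat =
        minGenerators A C := by
    have h2 := h.eventually (Metric.ball_mem_nhds _ one_pos)
    filter_upwards [h2] with n hn
    simp only [Nat.sub_self, Nat.factorial_zero, Nat.cast_one, one_mul, pow_zero, div_one] at hn
    change dist _ _ < (1 : ℝ) at hn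
    rw [Real.dist_eq, abs_lt] at hn
    obtain ⟨ha, hb⟩ := hn
    rw [neg_lt, neg_sub, sub_lt_iff_lt_add] at ha
    rw [sub_lt_iff_lt_add] at hb
    norm_cast at ha hb
    omega
  obtain ⟨n, hn, hn1⟩ := (h1.and (Filter.eventually_ge_atTop 1)).exists
  obtain ⟨k, rfl⟩ := Nat.exists_eq_add_of_le' hn1
  have hle : maximalIdeal A ^ (k + 1 + 1) • (⊤ : Submodule A C) ≤ maximalIdeal A • ⊤ :=
    Submodule.smul_mono_left (Ideal.pow_le_self (by omega))
  have hfl := isFiniteLength_quotient_pow_smul_top (A := A) (C := C) (k + 1 + 1)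
  have hlen : Module.length A (C ⧸ (maximalIdeal A ^ (k + 1 + 1) • (⊤ : Submodule A C))) =
      Module.length A (C ⧸ (maximalIdeal A • (⊤ : Submodule A C))) := by
    rw [length_quotient_maximalIdeal_smul_top, ← hn,
      ENat.natCast_toNat (Module.length_ne_top_iff.mpr hfl)]
  have hbot : maximalIdeal A • (⊤ : Submodule A C) ≤ maximalIdeal A ^ (k + 2) • ⊤ := by
    by_contra hlt
    obtain ⟨_, _⟩ := isFiniteLength_iff_isNoetherian_isArtinian.mp hfl
    have hq := Submodule.length_quotient_lt (R := A)
      ((maximalIdeal A • (⊤ : Submodule A C)).map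
        (maximalIdeal A ^ (k + 1 + 1) • (⊤ : Submodule A C)).mkQ) (by
          intro h0
          rw [← LinearMap.le_ker_iff_map, Submodule.ker_mkQ] at h0
          exact hlt h0)
    rw [(Submodule.quotientQuotientEquivQuotient _ _ hle).length_eq, hlen] at hq
    exact lt_irrefl _ hq
  have h0 := smul_top_eq_bot_of_le_pow hbot
  exact (Submodule.mem_bot A).mp (h0 ▸ Submodule.smul_mem_smul hc trivial)

end Length

/-- Prime avoidance: a module without socle has a regular element. -/
lemma exists_mem_maximalIdeal_isSMulRegular {A : Type*} [CommRing A] [IsLocalRing A]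
    [IsNoetherianRing A] {N : Type*} [AddCommGroup N] [Module A N] [Module.Finite A N]
    (h : ∀ z : N, (∀ c ∈ maximalIdeal A, c • z = 0) → z = 0) :
    ∃ t ∈ maximalIdeal A, IsSMulRegular N t := by
  by_contra hcon
  push Not at hcon
  have h1 : (maximalIdeal A : Set A) ⊆ ⋃ p ∈ associatedPrimes A N, (p : Set A) := by
    rw [biUnion_associatedPrimes_eq_compl_regular]
    exact hcon
  have hfin : (associatedPrimes A N).Finite := associatedPrimes.finite A N
  obtain ⟨p, hp, hle⟩ := (Ideal.subset_union_prime_finite hfin (f := id) ⊥ ⊥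
    (fun p hp _ _ => hp.1)).mp h1
  obtain ⟨hpp, z, hz⟩ := Submodule.isAssociatedPrime_iff.mp hp
  have hz0 : z = 0 := h z fun c hc => by
    have hcp : c ∈ p := hle hc
    rw [hz, Submodule.mem_colon_singleton] at hcp
    simpa using hcp
  refine hpp.ne_top ((Ideal.eq_top_iff_one _).mpr ?_)
  rw [hz, Submodule.mem_colon_singleton, hz0]
  simp

/-- In a one-dimensional Noetherian local ring, a regular element of the maximal ideal generates
an ideal that contains a power of the maximal ideal. -/
lemma exists_maximalIdeal_pow_le_span {R : Type*} [CommRing R] [IsLocalRing R]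
    [IsNoetherianRing R] (hdim : ringKrullDim R = 1) {t : R} (htm : t ∈ maximalIdeal R)
    (ht : IsSMulRegular R t) :
    IsArtinianRing (R ⧸ Ideal.span {t}) ∧ ∃ n, maximalIdeal R ^ n ≤ Ideal.span {t} := by
  have h1 := ringKrullDim_quotient_span_singleton_succ_eq_ringKrullDim ht htm
  have h2 : ringKrullDim (R ⧸ Ideal.span {t}) ≤ 0 := by
    rw [hdim] at h1
    generalize ringKrullDim (R ⧸ Ideal.span {t}) = d at h1
    cases d with
    | bot => simp
    | coe d =>
      cases d with
      | top => exact absurd h1 (by decide)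
      | coe d => norm_cast at h1 ⊢; omega
  have hart : IsArtinianRing (R ⧸ Ideal.span {t}) :=
    isArtinianRing_iff_isNoetherianRing_krullDimLE_zero.mpr ⟨inferInstance,
      (Ring.krullDimLE_iff).mpr (by simpa using h2)⟩
  exact ⟨hart, exists_maximalIdeal_pow_le_of_isArtinianRing_quotient _⟩

/-- The only place where the finite injective dimension of `R` enters. -/
lemma IsGorensteinLocalRing.hasArtinianSelfInjectiveQuotients {R : Type u} [CommRing R]
    [IsGorensteinLocalRing R] (hdim : ringKrullDim R = 1) :
    HasArtinianSelfInjectiveQuotients R where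
  exists_pow_le t htm ht := (exists_maximalIdeal_pow_le_span hdim htm ht).2
  exists_eq_mul t htm ht L f hf := by
    obtain ⟨n, hn⟩ := IsGorensteinLocalRing.exists_hasInjectiveDimensionLE (A := R)
    refine exists_eq_mk_mul hn ht htm ?_ L f fun x hx => hf x ?_
    · have hart := (exists_maximalIdeal_pow_le_span hdim htm ht).1
      have heq : Ideal.span {t} = t • (⊤ : Submodule R R) := by
        rw [← Submodule.ideal_span_singleton_smul]; simp
      rw [isFiniteLength_iff_isNoetherian_isArtinian]
      refine ⟨inferInstance, ?_⟩
      rw [← heq]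
      exact isArtinian_of_surjective_algebraMap (R := R ⧸ Ideal.span {t})
        Ideal.Quotient.mk_surjective
    · obtain ⟨y, -, hy⟩ := (Submodule.mem_smul_pointwise_iff_exists _ _ _).mp hx
      exact ⟨y, hy.symm⟩

lemma IsMaximalCohenMacaulay.exists_isSMulRegular {A : Type u} [CommRing A] [IsLocalRing A]
    [IsNoetherianRing A] (hdim : ringKrullDim A = 1) {K : Type v} [AddCommGroup K] [Module A K]
    (hK : IsMaximalCohenMacaulay A K) : ∃ r ∈ maximalIdeal A, IsSMulRegular K r := by
  obtain ⟨rs, hrs, hreg, hlen⟩ := hK.exists_isRegular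
  match rs with
  | [] => simp [hdim] at hlen
  | r :: rs =>
    exact ⟨r, hrs r (by simp),
      ((RingTheory.Sequence.isWeaklyRegular_cons_iff _ _ _).mp hreg.toIsWeaklyRegular).1⟩

end DimensionOne

/-! ### The idealization and the ideal cut out by its canonical module. -/

section Idealization

open Pointwise TrivSqZeroExt

variable {R : Type u} [CommRing R]

/-- The kernel of the projection to `R` squares to zero, so the spectra agree. -/
lemma ringKrullDim_trivSqZeroExt (I : Ideal R) :
    ringKrullDim (TrivSqZeroExt R I) = ringKrullDim R := by
  have hsurj : Function.Surjective (fstHom R R I).toRingHom := fun r => ⟨inl r, rfl⟩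
  have hker : ∀ x ∈ RingHom.ker (fstHom R R I).toRingHom, IsNilpotent x := by
    intro x hx
    refine ⟨2, ?_⟩
    have h0 : x.fst = 0 := hx
    rw [pow_two]
    ext <;> simp [h0]
  rw [← ringKrullDim_eq_of_ringEquiv (R := _ ⧸ RingHom.ker (fstHom R R I).toRingHom) (RingHom.quotientKerEquivOfSurjective hsurj),
    ringKrullDim_quotient]
  have huniv : PrimeSpectrum.zeroLocus
      (RingHom.ker (fstHom R R I).toRingHom : Set (TrivSqZeroExt R I)) = Set.univ := by
    refine Set.eq_univ_of_forall fun p x hx => ?_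
    obtain ⟨n, hn⟩ := hker x hx
    exact p.2.mem_of_pow_mem n (hn ▸ p.asIdeal.zero_mem)
  rw [huniv]
  exact (Order.krullDim_eq_of_orderIso OrderIso.Set.univ).symm

variable {I : Ideal R} [IsLocalRing R] [IsLocalRing (TrivSqZeroExt R I)]

lemma mem_maximalIdeal_trivSqZeroExt_iff {z : TrivSqZeroExt R I} :
    z ∈ maximalIdeal (TrivSqZeroExt R I) ↔ z.fst ∈ maximalIdeal R := by
  rw [mem_maximalIdeal, mem_nonunits_iff, isUnit_iff_isUnit_fst, mem_maximalIdeal,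
    mem_nonunits_iff]

omit [IsLocalRing R] [IsLocalRing (TrivSqZeroExt R I)] in
lemma isSMulRegular_fst {z : TrivSqZeroExt R I} (hz : IsSMulRegular (TrivSqZeroExt R I) z) :
    IsSMulRegular R z.fst := by
  have reg : ∀ {w : TrivSqZeroExt R I}, z * w = 0 → w = 0 := fun {w} h =>
    hz (h.trans (mul_zero z).symm)
  rw [isSMulRegular_iff_right_eq_zero_of_smul]
  intro b hb
  rw [smul_eq_mul] at hb
  -- If `z.fst * b = 0`, then `z * b` is concentrated in `I`, where `z` acts through `z.fst`, which
  -- kills it.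
  have h1 : z * (z * (inl b : TrivSqZeroExt R I)) = 0 := by
    ext
    · simp [hb]
    · have : z.fst * ((z.snd : R) * b) = 0 := by rw [mul_left_comm, hb, mul_zero]
      simpa [hb, mul_comm b] using this
  have h2 := congrArg TrivSqZeroExt.fst (reg (reg h1))
  simpa using h2

omit [IsLocalRing R] [IsLocalRing (TrivSqZeroExt R I)] in
lemma eq_zero_of_inl_mul_eq_zero {t : R} (ht : IsSMulRegular R t) {z : TrivSqZeroExt R I}
    (hz : inl t * z = 0) : z = 0 := by
  have reg : ∀ {b : R}, t * b = 0 → b = 0 := fun {b} h => ht (h.trans (mul_zero t).symm)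
  have h1 := congrArg TrivSqZeroExt.fst hz
  have h2 := congrArg (fun z : TrivSqZeroExt R I => (z.snd : R)) hz
  ext
  · exact reg (by simpa using h1)
  · exact reg (by simpa using h2)

/-- The relation on pairs attached to an ideal of the idealization. -/
def idealizationRel (P : Ideal (TrivSqZeroExt R I)) (a x : R) : Prop :=
  ∃ h : x ∈ I, (inl a + inr ⟨x, h⟩ : TrivSqZeroExt R I) ∈ P

lemma isSocleIdeal_idealizationRel {t : R} {P : Ideal (TrivSqZeroExt R I)}
    (htP : ∀ α, inl t * α ∈ P)
    (hdvd : ∀ α ∈ P, ∀ c ∈ maximalIdeal (TrivSqZeroExt R I), inl t ∣ c * α)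
    (hcyc : ∀ α α', (∀ c ∈ maximalIdeal (TrivSqZeroExt R I), c * α ∈ P) →
      (∀ c ∈ maximalIdeal (TrivSqZeroExt R I), c * α' ∈ P) → α ∉ P → ∃ l, α' - l * α ∈ P) :
    IsSocleIdeal t I (idealizationRel P) := by
  have hm : ∀ c ∈ maximalIdeal R, ∀ y : I,
      (inl c + inr y : TrivSqZeroExt R I) ∈ maximalIdeal (TrivSqZeroExt R I) := by
    intro c hc y
    rw [mem_maximalIdeal_trivSqZeroExt_iff]
    simpa using hc
  have hE : ∀ {a x : R} (hx : x ∈ I),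
      (∀ c ∈ maximalIdeal R, ∀ y ∈ I, idealizationRel P (c * a) (c * x + y * a)) →
      ∀ c ∈ maximalIdeal (TrivSqZeroExt R I),
        c * (inl a + inr ⟨x, hx⟩ : TrivSqZeroExt R I) ∈ P := by
    intro a x hx h c hc
    obtain ⟨h1, h2⟩ := h c.fst (mem_maximalIdeal_trivSqZeroExt_iff.mp hc) c.snd c.snd.2
    convert h2 using 1
    ext <;> simp [mul_comm a]
  refine ⟨?_, ?_, ?_, ?_, ?_, ?_⟩
  · rintro a x a' x' ⟨hx, h⟩ ⟨hx', h'⟩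
    refine ⟨I.add_mem hx hx', ?_⟩
    convert P.add_mem h h' using 1
    ext <;> simp
  · rintro a x c y hy ⟨hx, h⟩
    refine ⟨I.add_mem (I.mul_mem_left c hx) (I.mul_mem_right a hy), ?_⟩
    convert P.mul_mem_left (inl c + inr ⟨y, hy⟩ : TrivSqZeroExt R I) h using 1
    ext <;> simp
  · intro a x hx
    refine ⟨I.mul_mem_left t hx, ?_⟩
    convert htP (inl a + inr ⟨x, hx⟩ : TrivSqZeroExt R I) using 1
    ext <;> simp
  · rintro a x ⟨hx, h⟩ c hc
    obtain ⟨β, hβ⟩ := hdvd _ h _ (hm c hc 0)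
    refine ⟨⟨β.fst, ?_⟩, ⟨β.snd, ?_⟩⟩
    · simpa using congrArg TrivSqZeroExt.fst hβ
    · simpa using congrArg (fun z : TrivSqZeroExt R I => (z.snd : R)) hβ
  · rintro a x ⟨hx, h⟩ y hy
    obtain ⟨β, hβ⟩ := hdvd _ h _ (hm 0 (zero_mem _) ⟨y, hy⟩)
    refine ⟨β.snd, ?_⟩
    simpa [mul_comm a] using congrArg (fun z : TrivSqZeroExt R I => (z.snd : R)) hβ
  · rintro a x a' x' hx hx' h h' h0
    obtain ⟨l, hl⟩ := hcyc (inl a + inr ⟨x, hx⟩) (inl a' + inr ⟨x', hx'⟩) (hE hx h) (hE hx' h')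
      (fun hP => h0 ⟨hx, hP⟩)
    refine ⟨l.fst, l.snd, l.snd.2, I.sub_mem hx' (I.add_mem (I.mul_mem_left _ hx)
      (I.mul_mem_right _ l.snd.2)), ?_⟩
    convert hl using 1
    ext <;> simp [mul_comm a]

variable [IsNoetherianRing (TrivSqZeroExt R I)]

/-- An almost Gorenstein structure on the idealization gives rise to an ideal as in
`IsSocleIdeal`. -/
lemma exists_isSocleIdeal (hdim : ringKrullDim R = 1)
    {K : Type u} [AddCommGroup K] [Module (TrivSqZeroExt R I) K]
    (hK : IsCanonicalModule (TrivSqZeroExt R I) K)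
    (φ : TrivSqZeroExt R I →ₗ[TrivSqZeroExt R I] K) (hφ : Function.Injective φ)
    (hφK : ∀ c ∈ maximalIdeal (TrivSqZeroExt R I), ∀ z, c • z ∈ LinearMap.range φ)
    {t : R} (htm : t ∈ maximalIdeal R) (ht : IsSMulRegular R t) :
    ∃ B, IsSocleIdeal t I B := by
  have hdimA : ringKrullDim (TrivSqZeroExt R I) = 1 := (ringKrullDim_trivSqZeroExt I).trans hdim
  obtain ⟨r, hrm, hr⟩ := hK.toIsMaximalCohenMacaulay.exists_isSMulRegular hdimA
  let t' : TrivSqZeroExt R I := inl t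
  have htm' : t' ∈ maximalIdeal (TrivSqZeroExt R I) :=
    mem_maximalIdeal_trivSqZeroExt_iff.mpr htm
  -- If `t'z = 0`, then `rz` lies in the image of `φ`, where `t'` is regular; so `rz = 0` and `z =
  -- 0`.
  have htK : IsSMulRegular K t' := by
    rw [isSMulRegular_iff_right_eq_zero_of_smul]
    intro z hz
    refine (isSMulRegular_iff_right_eq_zero_of_smul.mp hr) z ?_
    obtain ⟨a, ha⟩ := hφK r hrm z
    have h1 : φ (t' • a) = 0 := by rw [map_smul, ha, smul_comm, hz, smul_zero]
    have h2 : t' • a = 0 := hφ (by rw [h1, map_zero])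
    rw [← ha, eq_zero_of_inl_mul_eq_zero ht h2, map_zero]
  have hext : Module.length (TrivSqZeroExt R I) (Abelian.Ext
      (ModuleCat.of (TrivSqZeroExt R I) (ResidueField (TrivSqZeroExt R I)))
      (ModuleCat.of (TrivSqZeroExt R I) K) 1) = 1 := by
    obtain ⟨d, hd, h⟩ := hK.type_eq_one
    obtain rfl : d = 1 := by rw [hdimA] at hd; exact_mod_cast hd.symm
    exact h
  let P : Submodule (TrivSqZeroExt R I) (TrivSqZeroExt R I) :=
    (t' • (⊤ : Submodule (TrivSqZeroExt R I) K)).comap φ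
  have hP : ∀ {α}, α ∈ P ↔ ∃ z, t' • z = φ α := by
    intro α
    rw [Submodule.mem_comap, Submodule.mem_smul_pointwise_iff_exists]
    simp
  have htP : ∀ α, t' * α ∈ P := fun α => hP.mpr ⟨φ α, (map_smul φ t' α).symm⟩
  have hdvd : ∀ α ∈ P, ∀ c ∈ maximalIdeal (TrivSqZeroExt R I), t' ∣ c * α := by
    intro α hα c hc
    obtain ⟨z, hz⟩ := hP.mp hα
    obtain ⟨β, hβ⟩ := hφK c hc z
    refine ⟨β, hφ ?_⟩
    rw [← smul_eq_mul, ← smul_eq_mul, map_smul, map_smul, hβ, ← hz, smul_comm]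
  have hcyc : ∀ α α', (∀ c ∈ maximalIdeal (TrivSqZeroExt R I), c * α ∈ P) →
      (∀ c ∈ maximalIdeal (TrivSqZeroExt R I), c * α' ∈ P) → α ∉ P → ∃ l, α' - l * α ∈ P := by
    intro α α' h h' h0
    obtain ⟨l, hl⟩ := exists_smul_sub_mem_of_length_ext_one hext htK htm' (z := φ α)
      (z' := φ α') (fun c hc => by rw [← map_smul]; exact h c hc)
      (fun c hc => by rw [← map_smul]; exact h' c hc) h0
    refine ⟨l, ?_⟩
    rw [← map_smul, ← map_sub] at hl
    exact hl
  exact ⟨_, isSocleIdeal_idealizationRel htP hdvd hcyc⟩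

end Idealization

/-! ### Recognizing discrete valuation rings among quotients. -/

section UniformizerModulo

variable {R : Type*} [CommRing R] [IsLocalRing R] [IsNoetherianRing R]

/-- If the maximal ideal of `R / L` is generated by the image of `x`, then every element outside
`L` is congruent to the product of a unit and a power of `x`. -/
lemma exists_sub_unit_mul_pow_mem {L : Ideal R} {x : R} (hx : x ∈ maximalIdeal R)
    (hm : maximalIdeal R ≤ L ⊔ Ideal.span {x}) {a : R} (ha : a ∉ L) :
    ∃ (u : Rˣ) (n : ℕ), a - u * x ^ n ∈ L := by
  classical
  have h : ∃ n, a ∉ L ⊔ Ideal.span {x ^ (n + 1)} := by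
    by_contra hcon
    push Not at hcon
    exact ha (Ideal.mem_of_forall_mem_sup_pow hx hcon)
  -- `N` is the order of `a` along `x` modulo `L`; by maximality the coefficient of `x ^ N` is a
  -- unit.
  obtain ⟨N, hn, hmem⟩ : ∃ N, a ∉ L ⊔ Ideal.span {x ^ (N + 1)} ∧ a ∈ L ⊔ Ideal.span {x ^ N} := by
    refine ⟨Nat.find h, Nat.find_spec h, ?_⟩
    rcases hk : Nat.find h with _ | k
    · simp
    · have := Nat.find_min h (m := k) (by omega)
      simpa using this
  obtain ⟨l, hl, _, hb, rfl⟩ := Submodule.mem_sup.mp hmem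
  obtain ⟨c, rfl⟩ := Ideal.mem_span_singleton'.mp hb
  have hc : IsUnit c := by
    refine isUnit_of_not_mem_maximalIdeal fun hc => hn ?_
    obtain ⟨l', hl', _, hd, rfl⟩ := Submodule.mem_sup.mp (hm hc)
    obtain ⟨d, rfl⟩ := Ideal.mem_span_singleton'.mp hd
    have : ∀ k, l + (l' + d * x) * x ^ k = (l + l' * x ^ k) + d * x ^ (k + 1) := by
      intro k; ring
    rw [this]
    exact Submodule.add_mem_sup (L.add_mem hl (L.mul_mem_right _ hl'))
      (Ideal.mul_mem_left _ _ (Ideal.mem_span_singleton_self _))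
  obtain ⟨u, rfl⟩ := hc
  exact ⟨u, N, by simpa using hl⟩

/-- If the maximal ideal of `R / L` is generated by the image of `x`, which is not nilpotent,
then `R / L` is a discrete valuation ring. -/
lemma exists_isDiscreteValuationRing_quotient {L : Ideal R} {x : R} (hx : x ∈ maximalIdeal R)
    (hm : maximalIdeal R ≤ L ⊔ Ideal.span {x}) (hxL : ∀ n, x ^ n ∉ L) :
    ∃ _ : IsDomain (R ⧸ L), IsDiscreteValuationRing (R ⧸ L) := by
  have hprime : L.IsPrime := by
    refine ⟨fun h => hxL 0 (h ▸ trivial), fun {a b} hab => ?_⟩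
    by_contra! hcon
    obtain ⟨u, n, hu⟩ := exists_sub_unit_mul_pow_mem hx hm hcon.1
    obtain ⟨w, k, hw⟩ := exists_sub_unit_mul_pow_mem hx hm hcon.2
    refine hxL (n + k) ((Ideal.unit_mul_mem_iff_mem L (u * w).isUnit).mp ?_)
    have : ((u * w : Rˣ) : R) * x ^ (n + k) =
        a * b - (a - u * x ^ n) * b - u * x ^ n * (b - w * x ^ k) := by
      push_cast; ring
    rw [this]
    exact L.sub_mem (L.sub_mem hab (L.mul_mem_right _ hu)) (L.mul_mem_left _ hw)
  have hdom : IsDomain (R ⧸ L) := Ideal.Quotient.isDomain L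
  have := IsLocalRing.of_surjective' (Ideal.Quotient.mk L) Ideal.Quotient.mk_surjective
  have := IsLocalHom.of_surjective (Ideal.Quotient.mk L) Ideal.Quotient.mk_surjective
  refine ⟨hdom, ?_⟩
  have hxm : Ideal.Quotient.mk L x ∈ maximalIdeal (R ⧸ L) := by simpa using hx
  have hmax : maximalIdeal (R ⧸ L) = Ideal.span {Ideal.Quotient.mk L x} := by
    refine le_antisymm (fun z hz => ?_) ((Ideal.span_singleton_le_iff_mem _).mpr hxm)
    obtain ⟨z, rfl⟩ := Ideal.Quotient.mk_surjective z
    obtain ⟨l, hl, _, hd, rfl⟩ := Submodule.mem_sup.mp (hm (by simpa using hz))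
    obtain ⟨d, rfl⟩ := Ideal.mem_span_singleton'.mp hd
    rw [map_add, Ideal.Quotient.eq_zero_iff_mem.mpr hl, zero_add, map_mul]
    exact Ideal.mul_mem_left _ _ (Ideal.mem_span_singleton_self _)
  have hfield : ¬ IsField (R ⧸ L) := by
    rw [IsLocalRing.isField_iff_maximalIdeal_eq]
    intro h
    rw [h, Ideal.mem_bot, Ideal.Quotient.eq_zero_iff_mem] at hxm
    exact hxL 1 (by simpa using hxm)
  have hprinc : (maximalIdeal (R ⧸ L)).IsPrincipal := ⟨_, hmax⟩
  exact ((IsDiscreteValuationRing.TFAE (R ⧸ L) hfield).out 4 0).mp hprinc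

end UniformizerModulo

/-! ### Reducing the embedding dimension of a regular local ring. -/

section RegularLocalRing

/-- The quotient of a regular local ring by an element of `𝔪 \ 𝔪 ^ 2` is regular, with smaller
embedding dimension. -/
lemma IsRegularLocalRing.quotient_span_singleton {S : Type*} [CommRing S] [IsRegularLocalRing S]
    {z : S} (hz : z ∈ maximalIdeal S) (hz2 : z ∉ maximalIdeal S * maximalIdeal S) :
    ∃ _ : IsRegularLocalRing (S ⧸ Ideal.span {z}),
      (maximalIdeal (S ⧸ Ideal.span {z})).spanFinrank < (maximalIdeal S).spanFinrank := by
  classical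
  have : Nontrivial (S ⧸ Ideal.span {z}) := Ideal.Quotient.nontrivial_iff.mpr fun h =>
    (maximalIdeal.isMaximal S).ne_top (top_le_iff.mp (h ▸
      ((Ideal.span_singleton_le_iff_mem _).mpr hz)))
  have := IsLocalRing.of_surjective' (Ideal.Quotient.mk (Ideal.span {z}))
    Ideal.Quotient.mk_surjective
  have := IsLocalHom.of_surjective (Ideal.Quotient.mk (Ideal.span {z}))
    Ideal.Quotient.mk_surjective
  obtain ⟨s, hs, hspan⟩ := Submodule.FG.exists_span_finset_card_eq_spanFinrank
    (maximalIdeal S).fg_of_isNoetherianRing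
  have hsm : ∀ i ∈ s, i ∈ maximalIdeal S := fun i hi => hspan ▸ Submodule.subset_span hi
  obtain ⟨f, -, hf⟩ := Submodule.mem_span_finset.mp (hspan ▸ hz : z ∈ Submodule.span S (s : Set S))
  -- As `z ∉ 𝔪²`, some coefficient is a unit, and the corresponding generator is redundant modulo
  -- `z`.
  obtain ⟨i, hi, hfi⟩ : ∃ i ∈ s, f i ∉ maximalIdeal S := by
    by_contra! hcon
    exact hz2 (hf ▸ Ideal.sum_mem _ fun i hi => Ideal.mul_mem_mul (hcon i hi) (hsm i hi))
  have hmap : maximalIdeal (S ⧸ Ideal.span {z}) ≤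
      Ideal.span ((s.erase i).image (Ideal.Quotient.mk (Ideal.span {z})) : Set _) := by
    set q := Ideal.Quotient.mk (Ideal.span {z})
    have hmem : ∀ j ∈ s.erase i, q j ∈ Ideal.span ((s.erase i).image q : Set _) := fun j hj =>
      Ideal.subset_span (Finset.mem_coe.mpr (Finset.mem_image_of_mem q hj))
    have hle : maximalIdeal S ≤ (Ideal.span ((s.erase i).image q : Set _)).comap q := by
      rw [← hspan]
      refine Submodule.span_le.mpr fun j hj => ?_
      rw [SetLike.mem_coe, Ideal.mem_comap]
      by_cases hji : j = i
      · subst hji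
        have hz0 : q (∑ a ∈ s, f a • a) = 0 := by
          rw [hf]
          exact Ideal.Quotient.eq_zero_iff_mem.mpr (Ideal.mem_span_singleton_self z)
        rw [← Finset.add_sum_erase s _ hi, map_add, map_sum] at hz0
        have h1 : q (f j • j) ∈ Ideal.span ((s.erase j).image q : Set _) := by
          rw [eq_neg_of_add_eq_zero_left hz0]
          refine neg_mem (Ideal.sum_mem _ fun k hk => ?_)
          rw [smul_eq_mul, map_mul]
          exact Ideal.mul_mem_left _ _ (hmem k hk)
        rw [smul_eq_mul, map_mul] at h1
        exact (Ideal.unit_mul_mem_iff_mem _ ((isUnit_of_not_mem_maximalIdeal hfi).map q)).mp h1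
      · exact hmem j (Finset.mem_erase.mpr ⟨hji, hj⟩)
    intro w hw
    obtain ⟨w, rfl⟩ := Ideal.Quotient.mk_surjective w
    exact hle (by simpa using hw)
  have hmap' : Ideal.span ((s.erase i).image (Ideal.Quotient.mk (Ideal.span {z})) : Set _) ≤
      maximalIdeal (S ⧸ Ideal.span {z}) := by
    refine Ideal.span_le.mpr fun w hw => ?_
    obtain ⟨j, hj, rfl⟩ := Finset.mem_image.mp (Finset.mem_coe.mp hw)
    simpa using hsm j (Finset.mem_of_mem_erase hj)
  have hcard : (maximalIdeal (S ⧸ Ideal.span {z})).spanFinrank + 1 ≤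
      (maximalIdeal S).spanFinrank := by
    rw [← hs, ← Finset.card_erase_add_one hi, le_antisymm hmap hmap']
    refine Nat.add_le_add_right ((Submodule.spanFinrank_span_le_ncard_of_finite
      (Finset.finite_toSet _)).trans ?_) 1
    rw [Set.ncard_coe_finset]
    exact Finset.card_image_le
  refine ⟨IsRegularLocalRing.of_spanFinrank_maximalIdeal_le _ ?_, hcard⟩
  -- The dimension drops by at most one and the embedding dimension by at least one, so regularity
  -- persists.
  have h1 := ringKrullDim_le_ringKrullDim_quotient_add_encard {z}
    (by simpa [IsLocalRing.ringJacobson_eq_maximalIdeal] using hz)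
  rw [← IsRegularLocalRing.spanFinrank_maximalIdeal, Set.encard_singleton] at h1
  generalize ringKrullDim (S ⧸ Ideal.span {z}) = d at h1
  cases d with
  | bot => simp at h1
  | coe d =>
    cases d with
    | top => exact le_top
    | coe d => norm_cast at h1 ⊢; omega

/-- A quotient of a regular local ring is a quotient of a regular local ring of the same embedding
dimension. -/
lemma exists_ker_le_maximalIdeal_mul {R : Type u} [CommRing R] [IsLocalRing R]
    (S₀ : Type v) [CommRing S₀] [IsRegularLocalRing S₀] (π₀ : S₀ →+* R)
    (hπ₀ : Function.Surjective π₀) :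
    ∃ (S : Type v) (_ : CommRing S) (_ : IsRegularLocalRing S) (π : S →+* R),
      Function.Surjective π ∧ RingHom.ker π ≤ maximalIdeal S * maximalIdeal S := by
  generalize hn : (maximalIdeal S₀).spanFinrank = n
  induction n using Nat.strong_induction_on generalizing S₀ with
  | _ n ih =>
    by_cases h : RingHom.ker π₀ ≤ maximalIdeal S₀ * maximalIdeal S₀
    · exact ⟨S₀, _, inferInstance, π₀, hπ₀, h⟩
    · obtain ⟨z, hz, hz2⟩ := SetLike.not_le_iff_exists.mp h
      obtain ⟨_, hlt⟩ := IsRegularLocalRing.quotient_span_singleton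
        (le_maximalIdeal (RingHom.ker_ne_top π₀) hz) hz2
      exact ih _ (hn ▸ hlt) (S₀ ⧸ Ideal.span {z}) (Ideal.Quotient.lift _ π₀ fun a ha => by
        obtain ⟨b, rfl⟩ := Ideal.mem_span_singleton.mp ha
        rw [map_mul, (RingHom.mem_ker).mp hz, zero_mul])
        (Ideal.Quotient.lift_surjective_of_surjective _ _ hπ₀) rfl

end RegularLocalRing

/-! ### The presentation `S / (X) ∩ (Y)` and the final assembly. -/

/-- If the maximal ideal of `R` is generated by `x` and `y`, where `x y = 0` and no power of `x` or
`y` lies in `(y)` or `(x)` respectively, then a surjection from a regular local ring onto `R`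
induces a presentation `R ≅ S / (X) ∩ (Y)` with `S` regular of dimension two. -/
theorem exists_ringEquiv_quotient_inf {R : Type u} [CommRing R] [IsLocalRing R]
    [IsNoetherianRing R] {x y : R} (hm : maximalIdeal R = Ideal.span {x, y})
    (hinf : Ideal.span {x} ⊓ Ideal.span {y} = ⊥)
    (hx : ∀ n, x ^ n ∉ Ideal.span {y}) (hy : ∀ n, y ^ n ∉ Ideal.span {x})
    (hprinc : ¬ (maximalIdeal R).IsPrincipal)
    (S₀ : Type v) [CommRing S₀] [IsRegularLocalRing S₀] (π₀ : S₀ →+* R)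
    (hπ₀ : Function.Surjective π₀) :
    ∃ (S : Type v) (_ : CommRing S) (_ : IsRegularLocalRing S) (X Y : S)
        (e : (S ⧸ (Ideal.span {X} ⊓ Ideal.span {Y})) ≃+* R),
        ringKrullDim S = 2 ∧
        IsLocalRing.maximalIdeal S = Ideal.span {X, Y} ∧
        Ideal.span {x} = Ideal.span {e (Ideal.Quotient.mk (Ideal.span {X} ⊓ Ideal.span {Y}) X)} ∧
        Ideal.span {y} =
          Ideal.span {e (Ideal.Quotient.mk (Ideal.span {X} ⊓ Ideal.span {Y}) Y)} := by
  obtain ⟨S, _, _, π, hπ, hker⟩ := exists_ker_le_maximalIdeal_mul S₀ π₀ hπ₀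
  have := IsLocalHom.of_surjective π hπ
  obtain ⟨X, rfl⟩ := hπ x
  obtain ⟨Y, rfl⟩ := hπ y
  have hmem : ∀ {s : S}, s ∈ maximalIdeal S ↔ π s ∈ maximalIdeal R := by
    intro s
    simp
  have hX : X ∈ maximalIdeal S := hmem.mpr (hm ▸ Ideal.subset_span (by simp))
  have hY : Y ∈ maximalIdeal S := hmem.mpr (hm ▸ Ideal.subset_span (by simp))
  have hmS : maximalIdeal S = Ideal.span {X, Y} := by
    refine le_antisymm (Ideal.le_of_le_sup_maximalIdeal_mul fun s hs => ?_)
      (Ideal.span_le.mpr (by rintro _ (rfl | rfl) <;> assumption))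
    have h1 := hmem.mp hs
    rw [hm, Ideal.mem_span_pair] at h1
    obtain ⟨a, b, hab⟩ := h1
    obtain ⟨a, rfl⟩ := hπ a
    obtain ⟨b, rfl⟩ := hπ b
    have h2 : s - (a * X + b * Y) ∈ RingHom.ker π := by
      rw [RingHom.mem_ker, map_sub, sub_eq_zero, map_add, map_mul, map_mul, hab]
    have : s = (a * X + b * Y) + (s - (a * X + b * Y)) := by ring
    rw [this]
    exact Submodule.add_mem_sup (Ideal.mem_span_pair.mpr ⟨a, b, rfl⟩) (hker h2)
  have hdim : ringKrullDim S = 2 := by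
    rw [← IsRegularLocalRing.spanFinrank_maximalIdeal]
    have hle : (maximalIdeal S).spanFinrank ≤ 2 := by
      rw [hmS]
      exact (Submodule.spanFinrank_span_le_ncard_of_finite (by simp)).trans
        ((Set.ncard_insert_le X {Y}).trans (by simp))
    have hge : 2 ≤ (maximalIdeal S).spanFinrank := by
      by_contra! hlt
      have hprincS : (maximalIdeal S).IsPrincipal := by
        rcases Nat.lt_succ_iff_lt_or_eq.mp hlt with h | h
        · rw [(Submodule.spanFinrank_eq_zero_iff_eq_bot
            (maximalIdeal S).fg_of_isNoetherianRing).mp (by omega)]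
          exact bot_isPrincipal
        · exact ((Submodule.spanFinrank_eq_one_iff _).mp h).1
      obtain ⟨Z, hZ⟩ := hprincS
      refine hprinc ⟨π Z, le_antisymm (fun r hr => ?_) ?_⟩
      · obtain ⟨r, rfl⟩ := hπ r
        have h1 := hmem.mpr hr
        rw [hZ] at h1
        obtain ⟨c, rfl⟩ := Ideal.mem_span_singleton'.mp h1
        exact Ideal.mem_span_singleton'.mpr ⟨π c, by rw [map_mul]⟩
      · refine (Ideal.span_singleton_le_iff_mem _).mpr (hmem.mp ?_)
        rw [hZ]
        exact Ideal.mem_span_singleton_self Z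
    rw [le_antisymm hle hge]; rfl
  have hkerle : ∀ {X Y : S}, Y ∈ maximalIdeal S → maximalIdeal S = Ideal.span {X, Y} →
      (∀ n, π Y ^ n ∉ Ideal.span {π X}) → RingHom.ker π ≤ Ideal.span {X} := by
    intro X Y hY hmS hYX c hc
    -- Modulo `X`, an element outside `(X)` is a unit times a power of `Y`; if it lay in the kernel,
    -- a power of `π Y` would lie in `(π X)`.
    by_contra hcX
    obtain ⟨u, n, h⟩ := exists_sub_unit_mul_pow_mem hY
      (hmS.trans (Ideal.span_insert X {Y})).le hcX
    obtain ⟨d, hd⟩ := Ideal.mem_span_singleton'.mp h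
    have h1 := congrArg π hd
    rw [map_sub, (RingHom.mem_ker).mp hc, map_mul, map_mul, map_pow] at h1
    refine hYX n ((Ideal.unit_mul_mem_iff_mem _ (u.isUnit.map π)).mp ?_)
    exact Ideal.mem_span_singleton'.mpr ⟨-π d, by linear_combination -h1⟩
  have hkeq : Ideal.span {X} ⊓ Ideal.span {Y} = RingHom.ker π := by
    refine le_antisymm (fun c hc => ?_) (le_inf (hkerle hY hmS hy)
      (hkerle hX (hmS.trans (by rw [Set.pair_comm])) hx))
    obtain ⟨a, rfl⟩ := Ideal.mem_span_singleton'.mp hc.1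
    obtain ⟨b, hb⟩ := Ideal.mem_span_singleton'.mp hc.2
    rw [RingHom.mem_ker, ← Submodule.mem_bot R, ← hinf]
    exact ⟨Ideal.mem_span_singleton'.mpr ⟨π a, by rw [map_mul]⟩,
      Ideal.mem_span_singleton'.mpr ⟨π b, by rw [← hb, map_mul]⟩⟩
  exact ⟨S, _, inferInstance, X, Y, (Ideal.quotEquivOfEq hkeq).trans
    (RingHom.quotientKerEquivOfSurjective hπ), hdim, hmS, rfl, rfl⟩

/-- If `x y = 0` and some combination of `x` and `y` is regular, then no power of `x` lies in
`(y)`, provided that `(x) ∩ (y) = 0`. -/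
lemma pow_notMem_span_singleton {R : Type*} [CommRing R] {t a b x y : R} (ht : IsSMulRegular R t)
    (hab : a * x + b * y = t) (hxy : x * y = 0) (hx0 : x ≠ 0)
    (hinf : Ideal.span {x} ⊓ Ideal.span {y} = ⊥) (hy : (1 : R) ∉ Ideal.span {y}) (n : ℕ) :
    x ^ n ∉ Ideal.span {y} := by
  -- On multiples of `x` the element `t` acts as `a * x`; so nilpotency of `x` would contradict
  -- regularity of `t`.
  have hpow : ∀ k, t ^ k * x = a ^ k * x ^ (k + 1) := by
    intro k
    induction k with
    | zero => simp
    | succ k ih =>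
      rw [pow_succ', mul_assoc, ih, ← hab]
      linear_combination (b * a ^ k * x ^ k) * hxy
  intro h
  rcases n with _ | n
  · exact hy (by simpa using h)
  · have h0 : x ^ (n + 1) = 0 := by
      rw [← Submodule.mem_bot R, ← hinf]
      exact ⟨Ideal.mem_span_singleton.mpr (dvd_pow_self x n.succ_ne_zero), h⟩
    have h1 := hpow n
    rw [h0, mul_zero] at h1
    exact hx0 ((ht.pow n) (h1.trans (mul_zero (t ^ n)).symm))

theorem corollary2p4 {R : Type u} [CommRing R] [IsGorensteinLocalRing R]
    (hdim : ringKrullDim R = 1) (I : Ideal R) (hI : I ≠ ⊥)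
    [IsCohenMacaulayLocalRing (R ⧸ I)] (hdimI : ringKrullDim (R ⧸ I) = 1)
    (hA : IsAlmostGorensteinLocalRing (TrivSqZeroExt R I))
    (J : Ideal R) (hJ : J = (⊥ : Ideal R).colon (I : Set R)) :
    (∃ _ : IsDomain (R ⧸ I), IsDiscreteValuationRing (R ⧸ I)) ∧
    (∃ _ : IsDomain (R ⧸ J), IsDiscreteValuationRing (R ⧸ J)) ∧
    I.spanFinrank = 1 ∧ J.spanFinrank = 1 ∧
    ((∃ (S₀ : Type v) (_ : CommRing S₀) (_ : IsRegularLocalRing S₀) (π : S₀ →+* R),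
        Function.Surjective π) →
      ∃ (S : Type v) (_ : CommRing S) (_ : IsRegularLocalRing S) (X Y : S)
        (e : (S ⧸ (Ideal.span {X} ⊓ Ideal.span {Y})) ≃+* R),
        ringKrullDim S = 2 ∧
        IsLocalRing.maximalIdeal S = Ideal.span {X, Y} ∧
        I = Ideal.span {e (Ideal.Quotient.mk (Ideal.span {X} ⊓ Ideal.span {Y}) X)} ∧
        J = Ideal.span {e (Ideal.Quotient.mk (Ideal.span {X} ⊓ Ideal.span {Y}) Y)}) := by
  have hR := IsGorensteinLocalRing.hasArtinianSelfInjectiveQuotients hdim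
  replace hJ : ∀ r, r ∈ J ↔ ∀ x ∈ I, r * x = 0 := by
    intro r
    rw [hJ, Submodule.mem_colon]
    simp
  have hdimA : ringKrullDim (TrivSqZeroExt R I) = 1 := (ringKrullDim_trivSqZeroExt I).trans hdim
  have hIm : I ≤ maximalIdeal R := le_maximalIdeal
    (Ideal.Quotient.nontrivial_iff.mp inferInstance)
  -- a common regular element of `R` and `R / I`
  obtain ⟨r₁, hr₁m, hr₁⟩ := (IsCohenMacaulayLocalRing.isMaximalCohenMacaulay
    (A := TrivSqZeroExt R I)).exists_isSMulRegular hdimA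
  obtain ⟨r₂, hr₂m, hr₂⟩ := (IsCohenMacaulayLocalRing.isMaximalCohenMacaulay
    (A := R ⧸ I)).exists_isSMulRegular hdimI
  have hr₁' := isSMulRegular_fst hr₁
  have hr₁m' := mem_maximalIdeal_trivSqZeroExt_iff.mp hr₁m
  obtain ⟨r₂, rfl⟩ := Ideal.Quotient.mk_surjective r₂
  have hlocal := IsLocalHom.of_surjective (Ideal.Quotient.mk I) Ideal.Quotient.mk_surjective
  have hr₂m' : r₂ ∈ maximalIdeal R := by simpa using hr₂m
  -- Each factor has a regular element of its own, so the direct sum has no socle and prime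
  -- avoidance gives one element that is regular on both.
  obtain ⟨t₀, ht₀m, ht₀⟩ := exists_mem_maximalIdeal_isSMulRegular (A := R) (N := R × (R ⧸ I)) (by
    rintro ⟨z₁, z₂⟩ hz
    have h1 : z₁ = 0 := hr₁' ((congrArg Prod.fst (hz _ hr₁m')).trans (smul_zero _).symm)
    have h2 : z₂ = 0 := hr₂ ((congrArg Prod.snd (hz _ hr₂m')).trans
      (smul_zero (Ideal.Quotient.mk I r₂)).symm)
    rw [h1, h2]; rfl)
  have ht₀R : IsSMulRegular R t₀ := fun a b hab =>
    congrArg Prod.fst (ht₀ (Prod.ext hab rfl : t₀ • ((a, 0) : R × (R ⧸ I)) = t₀ • (b, 0)))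
  have ht₀I : ∀ x, t₀ * x ∈ I → x ∈ I := by
    intro x hx
    have h1 : t₀ • ((0, Ideal.Quotient.mk I x) : R × (R ⧸ I)) = t₀ • 0 := by
      rw [smul_zero]
      refine Prod.ext (smul_zero t₀) ?_
      change t₀ • Ideal.Quotient.mk I x = 0
      rw [Algebra.smul_def, Ideal.Quotient.algebraMap_eq, ← map_mul]
      exact Ideal.Quotient.eq_zero_iff_mem.mpr hx
    exact Ideal.Quotient.eq_zero_iff_mem.mp (congrArg Prod.snd (ht₀ h1))
  -- The square puts the regular element in `𝔪²`, as the Nakayama arguments require.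
  obtain ⟨t, rfl⟩ : ∃ t, t = t₀ * t₀ := ⟨_, rfl⟩
  have htm : t₀ * t₀ ∈ maximalIdeal R := Ideal.mul_mem_left _ _ ht₀m
  have ht : IsSMulRegular R (t₀ * t₀) := ht₀R.mul ht₀R
  have htI : ∀ x, t₀ * t₀ * x ∈ I → x ∈ I := fun x hx =>
    ht₀I x (ht₀I _ (by rwa [← mul_assoc]))
  generalize htt : t₀ * t₀ = t at htm ht htI
  have reg : ∀ {a : R}, t * a = 0 → a = 0 := fun {a} h => ht (h.trans (mul_zero t).symm)
  -- the maximal ideal is the direct sum of `I` and `J`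
  have hle : maximalIdeal R ≤ I ⊔ J := by
    obtain ⟨d, K, _, _, hd, hK, φ, hφ, hC⟩ :=
      IsAlmostGorensteinLocalRing.exists_exact (A := TrivSqZeroExt R I)
    obtain rfl : d = 1 := by rw [hdimA] at hd; exact_mod_cast hd.symm
    have := hK.toIsMaximalCohenMacaulay.toFinite
    obtain ⟨B, hB⟩ := exists_isSocleIdeal hdim hK φ hφ (by
      intro c hc z
      rw [← Submodule.Quotient.mk_eq_zero, Submodule.Quotient.mk_smul]
      rcases hC with h | ⟨-, h⟩
      · exact Subsingleton.elim _ _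
      · exact h.smul_eq_zero hc _) htm ht
    exact maximalIdeal_le_sup_of_isSocleIdeal hR htm (htt ▸ Ideal.mul_mem_mul ht₀m ht₀m) ht hI hIm
      htI hJ hB
  have hJm : J ≤ maximalIdeal R := le_maximalIdeal fun h => by
    obtain ⟨x, hx, hx0⟩ := Submodule.exists_mem_ne_zero_of_ne_bot hI
    have h1 : (1 : R) ∈ J := h ▸ trivial
    exact hx0 (by simpa using (hJ 1).mp h1 x hx)
  have hsup : I ⊔ J = maximalIdeal R := le_antisymm (sup_le hIm hJm) hle
  have hJne : J ≠ ⊥ := by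
    rintro rfl
    rw [sup_bot_eq] at hsup
    exact (maximalIdeal.isMaximal R).ne_top ((Ideal.eq_top_iff_one _).mpr
      (hsup ▸ htI 1 (hsup ▸ Ideal.mul_mem_right _ _ htm)))
  -- Both components of `t` in `I + J` kill `I ∩ J`, since `IJ = 0`.
  have hinf : I ⊓ J = ⊥ := by
    refine le_bot_iff.mp fun z hz => reg ?_
    obtain ⟨a, ha, b, hb, hab⟩ := Submodule.mem_sup.mp (hle htm)
    have h1 := (hJ z).mp hz.2 a ha
    have h2 := (hJ b).mp hb z hz.1
    rw [← hab]
    linear_combination h1 + h2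
  obtain ⟨x, hx⟩ := exists_eq_span_singleton_of_sup_eq hR htm ht hI hJne hsup hinf
  obtain ⟨y, hy⟩ := exists_eq_span_singleton_of_sup_eq hR htm ht hJne hI
    (sup_comm I J ▸ hsup) (inf_comm I J ▸ hinf)
  subst hx hy
  have hm : maximalIdeal R = Ideal.span {x, y} := by rw [← hsup, Ideal.span_insert]
  have hxy : x * y = 0 := by
    rw [← Submodule.mem_bot R, ← hinf]
    exact ⟨Ideal.mul_mem_right _ _ (Ideal.mem_span_singleton_self x),
      Ideal.mul_mem_left _ _ (Ideal.mem_span_singleton_self y)⟩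
  have hx0 : x ≠ 0 := fun h => hI (Ideal.span_singleton_eq_bot.mpr h)
  have hy0 : y ≠ 0 := fun h => hJne (Ideal.span_singleton_eq_bot.mpr h)
  obtain ⟨a, b, hab⟩ := Ideal.mem_span_pair.mp (hm ▸ htm)
  have h1m : (1 : R) ∉ maximalIdeal R := fun h =>
    (maximalIdeal.isMaximal R).ne_top ((Ideal.eq_top_iff_one _).mpr h)
  have hxn := pow_notMem_span_singleton ht hab hxy hx0 hinf fun h => h1m (hJm h)
  have hyn := pow_notMem_span_singleton ht ((add_comm _ _).trans hab) ((mul_comm y x).trans hxy)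
    hy0 ((inf_comm _ _).trans hinf) fun h => h1m (hIm h)
  -- If `𝔪 = (z)`, then `x` and `y` are units times powers of `z`, so `xy = 0` makes `z` nilpotent;
  -- yet `z` divides the regular element `t`.
  have hprinc : ¬ (maximalIdeal R).IsPrincipal := by
    rintro ⟨z, hz⟩
    have hz' : maximalIdeal R = Ideal.span {z} := hz
    have hzm : z ∈ maximalIdeal R := hz' ▸ Ideal.mem_span_singleton_self z
    have hzb : maximalIdeal R ≤ ⊥ ⊔ Ideal.span {z} := by rw [bot_sup_eq, hz']
    obtain ⟨u, n, hu⟩ := exists_sub_unit_mul_pow_mem hzm hzb (L := ⊥) (a := x) (by simpa using hx0)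
    obtain ⟨w, k, hw⟩ := exists_sub_unit_mul_pow_mem hzm hzb (L := ⊥) (a := y) (by simpa using hy0)
    rw [Submodule.mem_bot, sub_eq_zero] at hu hw
    have h0 : z ^ (n + k) = 0 := by
      refine (u * w).isUnit.mul_right_eq_zero.mp ?_
      rw [← hxy, hu, hw]
      push_cast; ring
    obtain ⟨c, hc⟩ := Ideal.mem_span_singleton.mp (hz' ▸ htm)
    refine h1m (?_ : (1 : R) ∈ _)
    have h2 : (1 : R) = 0 := (ht.pow (n + k)) (by
      change t ^ (n + k) * 1 = t ^ (n + k) * 0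
      rw [hc, mul_pow, h0]; ring)
    rw [h2]
    exact zero_mem _
  refine ⟨exists_isDiscreteValuationRing_quotient
    (hJm (Ideal.mem_span_singleton_self y)) hle hyn,
    exists_isDiscreteValuationRing_quotient (hIm (Ideal.mem_span_singleton_self x))
      (sup_comm (Ideal.span {x}) (Ideal.span {y}) ▸ hle) hxn,
    Submodule.spanFinrank_singleton hx0, Submodule.spanFinrank_singleton hy0, ?_⟩
  rintro ⟨S₀, _, _, π, hπ⟩
  exact exists_ringEquiv_quotient_inf hm hinf hxn hyn hprinc S₀ π hπ
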